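/- Let $n\ge 3$ and let $C_n$ be the cycle with vertex set $\mathbb{Z}_n$, in which $i$ and $j$ are adjacent if and only if $i-j\equiv\pm1 \pmod n$, all edges having weight $1$. Let $\rho$ be a positive integer and $b\in\mathbb{Z}_n\setminus\{0\}$, and let $C_n+\rho\{0,b\}$ be the weighted graph obtained from $C_n$ by adding an edge of weight $\rho$ between $0$ and $b$ (if $b=\pm1$, the weight of the existing edge becomes $1+\rho$). Let $A$ be its weighted adjacency matrix, $\Delta$ the diagonal matrix of the row sums of $A$, $L=\Delta-A$ its Laplacian and $Q=\Delta+A$ its signless Laplacian. For $M\in\{L,Q\}$ put $U_M(t)=\exp(itM)$. Perfect vertex state transfer with respect to $M$ means that there are distinct vertices $u\neq v$ and a time $\tau>0$ with $$\mathbf e_v\mathbf e_v^{T}=U_M(\tau)\,\mathbf e_u\mathbf e_u^{T}\,U_M(-\tau)$$ (equivalently, $U_M(\tau)\mathbf e_u=\gamma\,\mathbf e_v$ for some $\gamma\in\mathbb{C}$). Then $C_n+\rho\{0,b\}$ admits no perfect vertex state transfer with respect to the Laplacian $L$ when $n\ge 15$, and none with respect to the signless Laplacian $Q$ when $n\ge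 9$. -/

import Mathlib

/-- An undirected weighted graph on the vertex set `V` without loops.
A pair `{u, v}` is an edge if and only if `weight u v` is positive, and `weight u v` is then
the weight of that edge. -/
structure WeightedGraph (V : Type*) where
  weight : V → V → ℝ
  symm : ∀ u v, weight u v = weight v u
  loopless : ∀ u, weight u u = 0
  nonneg : ∀ u v, 0 ≤ weight u v

namespace WeightedGraph

variable {V : Type*}

open Classical in
/-- A simple graph, all of whose edges get weight one. -/
noncomputable def ofSimpleGraph (G : SimpleGraph V) : WeightedGraph V where
  weight u v := if G.Adj u v then 1 else 0
  symm u v := by simp [G.adj_comm u v]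
  loopless u := by simp
  nonneg u v := by split_ifs <;> norm_num

/-- The weighted graph `G + ρ {a, b}`: an edge of weight `ρ` is added between the distinct
vertices `a` and `b`. If they are adjacent already, then the weight of that edge grows by `ρ`. -/
noncomputable def addEdge [DecidableEq V] (G : WeightedGraph V) (a b : V) (hab : a ≠ b) (ρ : ℝ) (hρ : 0 < ρ) :
    WeightedGraph V where
  weight u v :=
    G.weight u v + if (u = a ∧ v = b) ∨ (u = b ∧ v = a) then ρ else 0
  symm u v := by
    have h : ((u = a ∧ v = b) ∨ (u = b ∧ v = a)) ↔ ((v = a ∧ u = b) ∨ (v = b ∧ u = a)) := by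
      tauto
    rw [G.symm u v, if_congr h rfl rfl]
  loopless u := by
    have h : ¬ ((u = a ∧ u = b) ∨ (u = b ∧ u = a)) := by
      rintro (⟨h1, h2⟩ | ⟨h1, h2⟩)
      · exact hab (h1.symm.trans h2)
      · exact hab (h2.symm.trans h1)
    rw [if_neg h, G.loopless u, add_zero]
  nonneg u v := by
    have := G.nonneg u v
    split_ifs <;> linarith

/-- The adjacency matrix `A`. -/
def adjMatrix (G : WeightedGraph V) : Matrix V V ℝ := Matrix.of G.weight

variable [Fintype V] [DecidableEq V]

/-- The diagonal matrix `Δ` of the row sums of the adjacency matrix. -/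
def degMatrix (G : WeightedGraph V) : Matrix V V ℝ :=
  Matrix.diagonal fun u => ∑ v, G.adjMatrix u v

/-- The Laplacian matrix `L = Δ - A`. -/
def laplacian (G : WeightedGraph V) : Matrix V V ℝ := G.degMatrix - G.adjMatrix

/-- The signless Laplacian matrix `Q = Δ + A`. -/
def signlessLaplacian (G : WeightedGraph V) : Matrix V V ℝ := G.degMatrix + G.adjMatrix

end WeightedGraph

section QuantumWalk

variable {V : Type*} [Fintype V] [DecidableEq V]

/-- The transition matrix `U(t) = exp(i t M)` of the continuous-time quantum walk with
respect to the matrix `M`. -/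
noncomputable def transitionMatrix (M : Matrix V V ℝ) (t : ℝ) : Matrix V V ℂ :=
  NormedSpace.exp ((Complex.I * (t : ℂ)) • M.map Complex.ofReal)

/-- Perfect state transfer from `D₁` to `D₂` at time `τ`, relative to the matrix `M`:
`D₂ = U(τ) D₁ U(-τ)`. -/
def IsPSTAt (M : Matrix V V ℝ) (D₁ D₂ : Matrix V V ℂ) (τ : ℝ) : Prop :=
  D₂ = transitionMatrix M τ * D₁ * transitionMatrix M (-τ)

/-- The density matrix `e_a e_aᵀ` of the vertex state `e_a`. -/
def vertexState (a : V) : Matrix V V ℂ :=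
  Matrix.vecMulVec (Pi.single a 1) (Pi.single a 1)

/-- Perfect vertex state transfer occurs, relative to `M`, between some two distinct vertices
at some positive time. -/
def AdmitsVertexPST (M : Matrix V V ℝ) : Prop :=
  ∃ a b : V, a ≠ b ∧ ∃ τ : ℝ, 0 < τ ∧ IsPSTAt M (vertexState a) (vertexState b) τ

end QuantumWalk

/-- The cycle on the vertex set `ℤ/n`: distinct vertices `i` and `j` are adjacent if and only if
`i - j` is `1` or `-1` modulo `n`. -/
def cycleZMod (n : ℕ) : SimpleGraph (ZMod n) where
  Adj i j := i ≠ j ∧ (i - j = 1 ∨ i - j = -1)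
  symm := ⟨fun i j h => ⟨h.1.symm, by
    rcases h.2 with h | h
    · right; rw [← h]; ring
    · left; rw [← neg_sub, h, neg_neg]⟩⟩
  loopless := ⟨fun _ h => h.1 rfl⟩

/-- The edge-perturbed cycle `C_n + ρ {0, b}`. -/
noncomputable def edgePerturbedCycle (n : ℕ) (b : ZMod n) (hb : b ≠ 0) (ρ : ℝ) (hρ : 0 < ρ) :
    WeightedGraph (ZMod n) :=
  (WeightedGraph.ofSimpleGraph (cycleZMod n)).addEdge 0 b hb.symm ρ hρ

/-!
Both matrices have the form `K = K₀ + ρ χ χᵀ`, where `χ = e₀ + ε e_b`, `ε = -1` for the Laplacian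
and `ε = 1` for the signless one, and `K₀` is the corresponding matrix of the cycle. Since
`xᵀ K x = ∑ᵢ (xᵢ + ε xᵢ₊₁)² + ρ (x₀ + ε x_b)²`, all eigenvalues are nonnegative, and at most one
of them exceeds `4`, because the perturbation vanishes on the hyperplane `χ · x = 0`.

Suppose that the state of `u` is transferred to `v` at time `τ`. Eigenvectors `x`, `y` with
eigenvalues `θ`, `θ'` then satisfy `x_v y_v = exp (i τ (θ - θ')) x_u y_u`
(`mul_apply_of_isPSTAt`). So `x_v = ± x_u`, which splits the eigenvalue support `S` of `u` (the
eigenvalues with an eigenvector not vanishing at `u`) into a plus part, the support of `e_u + e_v`,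
and a minus part, the support of `e_u - e_v`; moreover all differences of elements of `S` are
integer multiples of `π / τ`.

The monic polynomial with root set `S` has rational coefficients: it is the monic polynomial of
least degree with `p(K) e_u = 0`, and applying a `ℚ`-linear retraction `ℝ → ℚ` to its coefficients
gives another one (`exists_rational_polynomial`). For the Laplacian, `0 ∈ S`, and rationality of
the sum of `S` makes all of `S` rational, hence integral (`forall_int_of_zero_mem`). For the
signless Laplacian, `S` consists of numbers `a + m η` with `a` and `η²` rational and `m` an integer;
if `η` is irrational, then `S` is stable under conjugation, and as it contains an eigenvalue above
`4` (the Perron eigenvalue) while its other elements lie in `[0, 4)`, it has at most three elements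
(`forall_int_or_card_le_three`).

When `S` consists of integers, it is contained in `{0, 1, 2, 3, 4, μ}`, and `4 ∉ S` for the signless
Laplacian. Either `S` has no two consecutive elements, or `exp (i τ) = -1` and each of the two parts
has constant parity. In each case `e_u`, `e_u + e_v` or `e_u - e_v` has a small support, that is, it
is annihilated by a polynomial in `K` of small degree. Up to an affine change, `K` is entrywise
nonnegative, positive exactly at equal or adjacent vertices. So an annihilating polynomial of degree
`d + 1` of a nonnegative vector forces the ball of radius `d` around its support to be everything
(`IsAdapted.le_card`), which bounds `n`; and if `e_u - e_v` is annihilated by a quadratic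
polynomial, then each vertex at distance two from `u` is at distance at most two from `v` and vice
versa, which is impossible for `n ≥ 9` (`IsAdapted.le_eight_of_quadratic_sub`).
-/

open Matrix Polynomial

/-! ### Eigenvalue supports of real symmetric matrices -/

section Spectral

variable {V : Type*} [Fintype V]

/-- All components of `z` along the eigenspaces of `M` belong to eigenvalues in `R`: an eigenvector
whose eigenvalue is not in `R` is orthogonal to `z`. -/
def SupportedOn (M : Matrix V V ℝ) (z : V → ℝ) (R : Finset ℝ) : Prop :=
  ∀ (x : V → ℝ) (θ : ℝ), M *ᵥ x = θ • x → x ⬝ᵥ z ≠ 0 → θ ∈ R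

theorem vecMul_eq_of_mulVec_eq {M : Matrix V V ℝ} (hM : M.IsSymm) {x : V → ℝ} {θ : ℝ}
    (h : M *ᵥ x = θ • x) : x ᵥ* M = θ • x := by
  rw [← h, ← vecMul_transpose, hM.eq]

theorem dotProduct_eigenvector_eq_zero {M : Matrix V V ℝ} (hM : M.IsSymm) {x y : V → ℝ} {θ θ' : ℝ}
    (hx : M *ᵥ x = θ • x) (hy : M *ᵥ y = θ' • y) (hne : θ ≠ θ') : x ⬝ᵥ y = 0 := by
  have h : x ⬝ᵥ (M *ᵥ y) = (x ᵥ* M) ⬝ᵥ y := dotProduct_mulVec x M y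
  rw [vecMul_eq_of_mulVec_eq hM hx, hy, dotProduct_smul, smul_dotProduct, smul_eq_mul,
    smul_eq_mul] at h
  have : (θ - θ') * (x ⬝ᵥ y) = 0 := by linear_combination -h
  exact (mul_eq_zero.1 this).resolve_left (sub_ne_zero.2 hne)

variable [DecidableEq V]

theorem eq_zero_of_forall_eigenvector_dotProduct {M : Matrix V V ℝ} (hM : M.IsSymm) (z : V → ℝ)
    (h : ∀ (x : V → ℝ) (θ : ℝ), M *ᵥ x = θ • x → x ⬝ᵥ z = 0) : z = 0 := by
  have hH : M.IsHermitian := by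
    rw [Matrix.IsHermitian, conjTranspose_eq_transpose_of_trivial]; exact hM
  have : WithLp.toLp 2 z = 0 := by
    apply hH.eigenvectorBasis.repr.injective
    ext j
    have := h _ _ (hH.mulVec_eigenvectorBasis j)
    simpa [OrthonormalBasis.repr_apply_apply, EuclideanSpace.inner_eq_star_dotProduct,
      dotProduct_comm] using this
  simpa using congrArg WithLp.ofLp this

/-- Stated for row eigenvectors, so that it does not depend on the symmetry of `M`. -/
theorem vecMul_aeval_of_vecMul_eq {M : Matrix V V ℝ} {x : V → ℝ} {θ : ℝ}
    (h : x ᵥ* M = θ • x) (f : ℝ[X]) : x ᵥ* aeval M f = f.eval θ • x := by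
  have hk : ∀ k : ℕ, x ᵥ* M ^ k = θ ^ k • x := by
    intro k
    induction k with
    | zero => simp
    | succ k ih => rw [pow_succ, ← vecMul_vecMul, ih, smul_vecMul, h, smul_smul, pow_succ]
  induction f using Polynomial.induction_on' with
  | add p q hp hq => simp [vecMul_add, hp, hq, add_smul]
  | monomial k a => simp [aeval_monomial, hk, Algebra.algebraMap_eq_smul_one, vecMul_smul, smul_smul]

theorem dotProduct_aeval_mulVec {M : Matrix V V ℝ} (hM : M.IsSymm) {x : V → ℝ} {θ : ℝ}
    (h : M *ᵥ x = θ • x) (f : ℝ[X]) (z : V → ℝ) :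
    x ⬝ᵥ (aeval M f *ᵥ z) = f.eval θ * (x ⬝ᵥ z) := by
  rw [dotProduct_mulVec, vecMul_aeval_of_vecMul_eq (vecMul_eq_of_mulVec_eq hM h), smul_dotProduct,
    smul_eq_mul]

theorem aeval_mulVec_eq_zero {M : Matrix V V ℝ} (hM : M.IsSymm) {z : V → ℝ} {f : ℝ[X]}
    (h : ∀ (x : V → ℝ) (θ : ℝ), M *ᵥ x = θ • x → x ⬝ᵥ z ≠ 0 → f.eval θ = 0) :
    aeval M f *ᵥ z = 0 := by
  refine eq_zero_of_forall_eigenvector_dotProduct hM _ fun x θ hx => ?_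
  rw [dotProduct_aeval_mulVec hM hx]
  by_cases hz : x ⬝ᵥ z = 0
  · rw [hz, mul_zero]
  · rw [h x θ hx hz, zero_mul]

/-- The polynomial with root set `R`, times a power of `X` to reach the exact degree `d`. -/
theorem SupportedOn.exists_monic {M : Matrix V V ℝ} (hM : M.IsSymm) {z : V → ℝ} {R : Finset ℝ}
    (h : SupportedOn M z R) {d : ℕ} (hd : R.card ≤ d) :
    ∃ f : ℝ[X], f.Monic ∧ f.natDegree = d ∧ aeval M f *ᵥ z = 0 := by
  have hm : (∏ r ∈ R, (X - C r)).Monic := monic_prod_X_sub_C _ _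
  refine ⟨(∏ r ∈ R, (X - C r)) * X ^ (d - R.card), hm.mul (monic_X_pow _), ?_, ?_⟩
  · rw [hm.natDegree_mul (monic_X_pow _), natDegree_prod_of_monic _ _ fun r _ => monic_X_sub_C r]
    simp; omega
  · refine aeval_mulVec_eq_zero hM fun x θ hx hz => ?_
    rw [eval_mul, eval_prod, Finset.prod_eq_zero (h x θ hx hz) (by simp), zero_mul]

theorem SupportedOn.const_sub {M : Matrix V V ℝ} {z : V → ℝ} {R : Finset ℝ}
    (h : SupportedOn M z R) (c : ℝ) :
    SupportedOn (c • (1 : Matrix V V ℝ) - M) z (R.image fun r => c - r) := by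
  intro x θ hx hz
  refine Finset.mem_image.2 ⟨c - θ, h x _ ?_ hz, by ring⟩
  rw [sub_mulVec, smul_mulVec, one_mulVec] at hx
  rw [sub_smul, ← hx, sub_sub_cancel]

theorem exists_eigenvector_apply_ne_zero {M : Matrix V V ℝ} (hM : M.IsSymm) (u : V) :
    ∃ (x : V → ℝ) (θ : ℝ), M *ᵥ x = θ • x ∧ x u ≠ 0 := by
  by_contra! h
  have := eq_zero_of_forall_eigenvector_dotProduct hM (Pi.single u 1) fun x θ hx => by
    simpa using h x θ hx
  simpa using congrFun this u

theorem finite_eigenvalues (M : Matrix V V ℝ) :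
    {θ : ℝ | ∃ x : V → ℝ, M *ᵥ x = θ • x ∧ x ≠ 0}.Finite := by
  refine (Module.End.finite_hasEigenvalue (Matrix.toLin' M)).subset ?_
  rintro θ ⟨x, hx, h0⟩
  exact Module.End.hasEigenvalue_of_hasEigenvector (x := x)
    ⟨Module.End.mem_eigenspace_iff.2 (by simpa using hx), h0⟩

theorem finite_eigenvalueSupport (M : Matrix V V ℝ) (u : V) :
    {θ : ℝ | ∃ x : V → ℝ, M *ᵥ x = θ • x ∧ x u ≠ 0}.Finite :=
  (finite_eigenvalues M).subset fun _ ⟨x, hx, h⟩ => ⟨x, hx, fun h0 => h (by simp [h0])⟩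

/-- The eigenvalue support of the vertex `u`: the eigenvalues having an eigenvector that does not
vanish at `u`. -/
noncomputable def eigenvalueSupport (M : Matrix V V ℝ) (u : V) : Finset ℝ :=
  (finite_eigenvalueSupport M u).toFinset

theorem mem_eigenvalueSupport {M : Matrix V V ℝ} {u : V} {θ : ℝ} :
    θ ∈ eigenvalueSupport M u ↔ ∃ x : V → ℝ, M *ᵥ x = θ • x ∧ x u ≠ 0 := by
  simp [eigenvalueSupport]

theorem supportedOn_single {M : Matrix V V ℝ} {u : V} {R : Finset ℝ}
    (h : eigenvalueSupport M u ⊆ R) : SupportedOn M (Pi.single u 1) R :=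
  fun x _ hx hz => h (mem_eigenvalueSupport.2 ⟨x, hx, by simpa using hz⟩)

theorem isIntegral_of_mem_eigenvalueSupport {Z : Matrix V V ℤ} {u : V} {θ : ℝ}
    (h : θ ∈ eigenvalueSupport (Z.map (Int.cast : ℤ → ℝ)) u) : IsIntegral ℤ θ := by
  obtain ⟨x, hx, hu⟩ := mem_eigenvalueSupport.1 h
  refine ⟨Z.charpoly, Z.charpoly_monic, ?_⟩
  have h1 : (Z.map (Int.cast : ℤ → ℝ)).charpoly = Z.charpoly.map (Int.castRingHom ℝ) :=
    Matrix.charpoly_map Z (Int.castRingHom ℝ)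
  rw [algebraMap_int_eq, ← eval_map, ← h1, Matrix.eval_charpoly]
  refine Matrix.exists_mulVec_eq_zero_iff.1 ⟨x, fun h0 => hu (by simp [h0]), ?_⟩
  rw [sub_mulVec, hx, scalar_apply, ← smul_one_eq_diagonal, smul_mulVec, one_mulVec, sub_self]

end Spectral

/-! ### Perfect state transfer and eigenvectors -/

section Transfer

variable {V : Type*} [Fintype V] [DecidableEq V]

theorem mulVec_exp_of_mulVec_eq {A : Matrix V V ℂ} {x : V → ℂ} {θ : ℂ} (h : A *ᵥ x = θ • x) :
    NormedSpace.exp A *ᵥ x = Complex.exp θ • x := by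
  have hk : ∀ k : ℕ, A ^ k *ᵥ x = θ ^ k • x := by
    intro k
    induction k with
    | zero => simp
    | succ k ih => rw [pow_succ, ← mulVec_mulVec, h, mulVec_smul, ih, smul_smul, pow_succ']
  let _ : NormedRing (Matrix V V ℂ) := Matrix.linftyOpNormedRing
  let _ : NormedAlgebra ℂ (Matrix V V ℂ) := Matrix.linftyOpNormedAlgebra
  have h1 := NormedSpace.exp_series_hasSum_exp' (𝕂 := ℂ) A
  have h2 := NormedSpace.exp_series_hasSum_exp' (𝕂 := ℂ) θ
  let φ : Matrix V V ℂ →+ (V → ℂ) :=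
    { toFun := fun B => B *ᵥ x, map_zero' := zero_mulVec x, map_add' := fun B C => add_mulVec B C x }
  have hφ : Continuous φ := continuous_id.matrix_mulVec continuous_const
  have h3 := h1.map φ hφ
  have h4 := h2.smul_const x
  rw [← Complex.exp_eq_exp_ℂ] at h4
  refine h3.unique ?_
  convert h4 using 1
  ext k i
  simp [φ, hk, smul_mulVec, mul_assoc]

theorem transitionMatrix_mulVec {M : Matrix V V ℝ} {x : V → ℝ} {θ : ℝ} (h : M *ᵥ x = θ • x)
    (t : ℝ) : transitionMatrix M t *ᵥ (fun i => (x i : ℂ)) =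
      Complex.exp (Complex.I * t * θ) • fun i => (x i : ℂ) := by
  refine mulVec_exp_of_mulVec_eq ?_
  ext i
  have := congrFun h i
  simp only [mulVec, dotProduct, Pi.smul_apply, smul_eq_mul] at this
  simp only [mulVec, dotProduct, Pi.smul_apply, smul_eq_mul]
  rw [mul_assoc, ← Complex.ofReal_mul, ← this]
  simp [Finset.mul_sum, mul_assoc]

theorem transitionMatrix_isSymm {M : Matrix V V ℝ} (hM : M.IsSymm) (t : ℝ) :
    (transitionMatrix M t).IsSymm := by
  refine IsSymm.exp ?_
  rw [IsSymm, transpose_smul, ← transpose_map, hM.eq]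

/-- The sign and phase relations between eigenvectors that state transfer imposes.
It results from pairing `e_v e_vᵀ = U(τ) e_u e_uᵀ U(-τ)` with `x` on the left and `y` on the right. -/
theorem mul_apply_of_isPSTAt {M : Matrix V V ℝ} (hM : M.IsSymm) {u v : V} {τ : ℝ}
    (h : IsPSTAt M (vertexState u) (vertexState v) τ) {x y : V → ℝ} {θ θ' : ℝ}
    (hx : M *ᵥ x = θ • x) (hy : M *ᵥ y = θ' • y) :
    ((x v * y v : ℝ) : ℂ) = Complex.exp (Complex.I * τ * (θ - θ')) * ((x u * y u : ℝ) : ℂ) := by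
  have key : ∀ (w : V) (a b : V → ℂ),
      a ⬝ᵥ (vertexState w *ᵥ b) = a w * b w := by
    intro w a b
    rw [vertexState, vecMulVec_mulVec]
    simp [dotProduct_comm, mul_comm]
  have h1 := congrArg (fun B => (fun i => (x i : ℂ)) ⬝ᵥ (B *ᵥ fun i => (y i : ℂ))) h
  simp only [← mulVec_mulVec] at h1
  rw [transitionMatrix_mulVec hy, dotProduct_mulVec _ (transitionMatrix M τ),
    ← mulVec_transpose, (transitionMatrix_isSymm hM τ).eq, transitionMatrix_mulVec hx,
    mulVec_smul, smul_dotProduct, dotProduct_smul, key, key, smul_eq_mul, smul_eq_mul] at h1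
  push_cast
  rw [h1, mul_sub, sub_eq_add_neg, Complex.exp_add]
  push_cast
  ring_nf

/-- Compare the traces of `M e_v e_vᵀ` and `M e_u e_uᵀ`, using that `M` commutes with `U(τ)`. -/
theorem diag_eq_of_isPSTAt {M : Matrix V V ℝ} {u v : V} {τ : ℝ}
    (h : IsPSTAt M (vertexState u) (vertexState v) τ) : M u u = M v v := by
  have key : ∀ w : V, (M.map Complex.ofReal * vertexState w).trace = (M w w : ℂ) := by
    intro w
    rw [vertexState, mul_vecMulVec, trace_vecMulVec]
    simp
  have hinv : transitionMatrix M (-τ) * transitionMatrix M τ = 1 := by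
    rw [transitionMatrix, transitionMatrix, ← exp_add_of_commute]
    · rw [← add_smul]
      simp
    · exact ((Commute.refl _).smul_left _).smul_right _
  have hcomm : M.map Complex.ofReal * transitionMatrix M τ =
      transitionMatrix M τ * M.map Complex.ofReal :=
    (((Commute.refl (M.map Complex.ofReal)).smul_right _).exp_right).eq
  have h1 := key v
  rw [h, ← Matrix.mul_assoc, ← Matrix.mul_assoc, hcomm, trace_mul_comm, ← Matrix.mul_assoc,
    ← Matrix.mul_assoc, hinv, Matrix.one_mul, key] at h1
  exact_mod_cast h1

open Classical in
/-- The eigenvalues in the support of `u` with an eigenvector taking equal nonzero values at `u`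
and `v`. -/
noncomputable def plusSupport (M : Matrix V V ℝ) (u v : V) : Finset ℝ :=
  (eigenvalueSupport M u).filter fun θ => ∃ x : V → ℝ, M *ᵥ x = θ • x ∧ x u ≠ 0 ∧ x v = x u

open Classical in
/-- The eigenvalues in the support of `u` with an eigenvector taking opposite nonzero values at `u`
and `v`. -/
noncomputable def minusSupport (M : Matrix V V ℝ) (u v : V) : Finset ℝ :=
  (eigenvalueSupport M u).filter fun θ => ∃ x : V → ℝ, M *ᵥ x = θ • x ∧ x u ≠ 0 ∧ x v = -x u

theorem mem_plusSupport {M : Matrix V V ℝ} {u v : V} {θ : ℝ} :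
    θ ∈ plusSupport M u v ↔ ∃ x : V → ℝ, M *ᵥ x = θ • x ∧ x u ≠ 0 ∧ x v = x u := by
  simp only [plusSupport, Finset.mem_filter, mem_eigenvalueSupport, and_iff_right_iff_imp]
  exact fun ⟨x, h1, h2, _⟩ => ⟨x, h1, h2⟩

theorem mem_minusSupport {M : Matrix V V ℝ} {u v : V} {θ : ℝ} :
    θ ∈ minusSupport M u v ↔ ∃ x : V → ℝ, M *ᵥ x = θ • x ∧ x u ≠ 0 ∧ x v = -x u := by
  simp only [minusSupport, Finset.mem_filter, mem_eigenvalueSupport, and_iff_right_iff_imp]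
  exact fun ⟨x, h1, h2, _⟩ => ⟨x, h1, h2⟩

theorem plusSupport_subset (M : Matrix V V ℝ) (u v : V) :
    plusSupport M u v ⊆ eigenvalueSupport M u := fun _ hθ =>
  let ⟨x, h1, h2, _⟩ := mem_plusSupport.1 hθ
  mem_eigenvalueSupport.2 ⟨x, h1, h2⟩

theorem minusSupport_subset (M : Matrix V V ℝ) (u v : V) :
    minusSupport M u v ⊆ eigenvalueSupport M u := fun _ hθ =>
  let ⟨x, h1, h2, _⟩ := mem_minusSupport.1 hθ
  mem_eigenvalueSupport.2 ⟨x, h1, h2⟩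

section PST

variable {M : Matrix V V ℝ} (hM : M.IsSymm) {u v : V} {τ : ℝ}
  (h : IsPSTAt M (vertexState u) (vertexState v) τ)

include hM h

theorem apply_eq_or_eq_neg_of_isPSTAt {x : V → ℝ} {θ : ℝ} (hx : M *ᵥ x = θ • x) :
    x v = x u ∨ x v = -x u := by
  have h1 := mul_apply_of_isPSTAt hM h hx hx
  rw [sub_self, mul_zero, Complex.exp_zero, one_mul] at h1
  exact mul_self_eq_mul_self_iff.1 (by exact_mod_cast h1)

theorem mem_plusSupport_or_mem_minusSupport {θ : ℝ} (hθ : θ ∈ eigenvalueSupport M u) :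
    θ ∈ plusSupport M u v ∨ θ ∈ minusSupport M u v := by
  obtain ⟨x, hx, hu⟩ := mem_eigenvalueSupport.1 hθ
  rcases apply_eq_or_eq_neg_of_isPSTAt hM h hx with h1 | h1
  · exact Or.inl (mem_plusSupport.2 ⟨x, hx, hu, h1⟩)
  · exact Or.inr (mem_minusSupport.2 ⟨x, hx, hu, h1⟩)

theorem supportedOn_minusSupport :
    SupportedOn M (Pi.single u 1 - Pi.single v 1) (minusSupport M u v) := by
  intro x θ hx hz
  simp only [dotProduct_sub, dotProduct_single, mul_one] at hz
  rcases apply_eq_or_eq_neg_of_isPSTAt hM h hx with h1 | h1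
  · exact absurd (by rw [h1, sub_self]) hz
  · exact mem_minusSupport.2 ⟨x, hx, fun h0 => hz (by rw [h1, h0]; simp), h1⟩

theorem supportedOn_plusSupport :
    SupportedOn M (Pi.single u 1 + Pi.single v 1) (plusSupport M u v) := by
  intro x θ hx hz
  simp only [dotProduct_add, dotProduct_single, mul_one] at hz
  rcases apply_eq_or_eq_neg_of_isPSTAt hM h hx with h1 | h1
  · exact mem_plusSupport.2 ⟨x, hx, fun h0 => hz (by rw [h1, h0]; simp), h1⟩
  · exact absurd (by rw [h1, add_neg_cancel]) hz

theorem exp_eq_one_of_mem_plusSupport {θ θ' : ℝ} (hθ : θ ∈ plusSupport M u v)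
    (hθ' : θ' ∈ plusSupport M u v) : Complex.exp (Complex.I * τ * (θ - θ')) = 1 := by
  obtain ⟨x, hx, hxu, hxv⟩ := mem_plusSupport.1 hθ
  obtain ⟨y, hy, hyu, hyv⟩ := mem_plusSupport.1 hθ'
  have h1 := mul_apply_of_isPSTAt hM h hx hy
  rw [hxv, hyv] at h1
  have h2 : ((x u * y u : ℝ) : ℂ) ≠ 0 := by exact_mod_cast mul_ne_zero hxu hyu
  exact mul_right_cancel₀ h2 (by rw [one_mul, ← h1])

theorem exp_eq_one_of_mem_minusSupport {θ θ' : ℝ} (hθ : θ ∈ minusSupport M u v)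
    (hθ' : θ' ∈ minusSupport M u v) : Complex.exp (Complex.I * τ * (θ - θ')) = 1 := by
  obtain ⟨x, hx, hxu, hxv⟩ := mem_minusSupport.1 hθ
  obtain ⟨y, hy, hyu, hyv⟩ := mem_minusSupport.1 hθ'
  have h1 := mul_apply_of_isPSTAt hM h hx hy
  rw [hxv, hyv, neg_mul_neg] at h1
  have h2 : ((x u * y u : ℝ) : ℂ) ≠ 0 := by exact_mod_cast mul_ne_zero hxu hyu
  exact mul_right_cancel₀ h2 (by rw [one_mul, ← h1])

theorem exp_eq_neg_one_of_mem {θ θ' : ℝ} (hθ : θ ∈ minusSupport M u v)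
    (hθ' : θ' ∈ plusSupport M u v) : Complex.exp (Complex.I * τ * (θ - θ')) = -1 := by
  obtain ⟨x, hx, hxu, hxv⟩ := mem_minusSupport.1 hθ
  obtain ⟨y, hy, hyu, hyv⟩ := mem_plusSupport.1 hθ'
  have h1 := mul_apply_of_isPSTAt hM h hx hy
  rw [hxv, hyv, neg_mul] at h1
  have h2 : ((x u * y u : ℝ) : ℂ) ≠ 0 := by exact_mod_cast mul_ne_zero hxu hyu
  refine mul_right_cancel₀ h2 ?_
  rw [← h1]; push_cast; ring

theorem exp_eq_one_or_neg_one {θ θ' : ℝ} (hθ : θ ∈ eigenvalueSupport M u)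
    (hθ' : θ' ∈ eigenvalueSupport M u) :
    Complex.exp (Complex.I * τ * (θ - θ')) = 1 ∨ Complex.exp (Complex.I * τ * (θ - θ')) = -1 := by
  rcases mem_plusSupport_or_mem_minusSupport hM h hθ with h1 | h1 <;>
    rcases mem_plusSupport_or_mem_minusSupport hM h hθ' with h2 | h2
  · exact Or.inl (exp_eq_one_of_mem_plusSupport hM h h1 h2)
  · right
    have h3 := exp_eq_neg_one_of_mem hM h h2 h1
    rw [← neg_sub (θ' : ℂ), mul_neg, Complex.exp_neg, h3]
    norm_num
  · exact Or.inr (exp_eq_neg_one_of_mem hM h h1 h2)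
  · exact Or.inl (exp_eq_one_of_mem_minusSupport hM h h1 h2)

theorem exists_int_mul_eq_sub {θ θ' : ℝ} (hθ : θ ∈ eigenvalueSupport M u)
    (hθ' : θ' ∈ eigenvalueSupport M u) : ∃ k : ℤ, τ * (θ - θ') = k * Real.pi := by
  have h1 : Complex.exp (2 * (Complex.I * τ * (θ - θ'))) = 1 := by
    rw [two_mul, Complex.exp_add]
    rcases exp_eq_one_or_neg_one hM h hθ hθ' with h1 | h1 <;> rw [h1] <;> norm_num
  obtain ⟨k, hk⟩ := Complex.exp_eq_one_iff.1 h1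
  refine ⟨k, ?_⟩
  have h2 : ((τ * (θ - θ') : ℝ) : ℂ) = ((k * Real.pi : ℝ) : ℂ) := by
    have : (2 * Complex.I) ≠ 0 := by simp
    refine mul_left_cancel₀ this ?_
    push_cast
    linear_combination hk
  exact_mod_cast h2

theorem minusSupport_nonempty (huv : u ≠ v) : (minusSupport M u v).Nonempty := by
  by_contra! h0
  have h1 := supportedOn_minusSupport hM h
  rw [h0] at h1
  have h2 := eq_zero_of_forall_eigenvector_dotProduct hM _ fun x θ hx => by
    by_contra hz
    simpa using h1 x θ hx hz
  have h3 := congrFun h2 u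
  simp [huv] at h3

theorem plusSupport_nonempty (huv : u ≠ v) : (plusSupport M u v).Nonempty := by
  by_contra! h0
  have h1 := supportedOn_plusSupport hM h
  rw [h0] at h1
  have h2 := eq_zero_of_forall_eigenvector_dotProduct hM _ fun x θ hx => by
    by_contra hz
    simpa using h1 x θ hx hz
  have h3 := congrFun h2 u
  simp [huv] at h3

/-- Two consecutive elements of the support give `exp (i τ) = ±1`. If the support is integral, the
value `1` would make all signs equal, although both signs occur. -/
theorem forall_add_one_notMem_or_exp_eq_neg_one (huv : u ≠ v)
    (hint : ∀ θ ∈ eigenvalueSupport M u, ∃ k : ℤ, θ = k) :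
    (∀ θ ∈ eigenvalueSupport M u, θ + 1 ∉ eigenvalueSupport M u) ∨
      Complex.exp (Complex.I * τ) = -1 := by
  by_contra! hcon
  obtain ⟨⟨θ, hθ, hθ'⟩, hE⟩ := hcon
  have h1 := exp_eq_one_or_neg_one hM h hθ' hθ
  have h2 : Complex.I * τ * (((θ + 1 : ℝ) : ℂ) - θ) = Complex.I * τ := by push_cast; ring
  rw [h2] at h1
  replace h1 := h1.resolve_right hE
  obtain ⟨α, hα⟩ := minusSupport_nonempty hM h huv
  obtain ⟨β, hβ⟩ := plusSupport_nonempty hM h huv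
  have h3 := exp_eq_neg_one_of_mem hM h hα hβ
  obtain ⟨k, rfl⟩ := hint α (minusSupport_subset _ _ _ hα)
  obtain ⟨l, rfl⟩ := hint β (plusSupport_subset _ _ _ hβ)
  have h4 : Complex.I * τ * (((k : ℝ) : ℂ) - ((l : ℝ) : ℂ)) = ((k - l : ℤ) : ℂ) * (Complex.I * τ) := by
    push_cast; ring
  rw [h4, Complex.exp_int_mul, h1, _root_.one_zpow] at h3
  norm_num at h3

theorem add_one_notMem_plusSupport (hE : Complex.exp (Complex.I * τ) = -1) {θ : ℝ}
    (hθ : θ ∈ plusSupport M u v) : θ + 1 ∉ plusSupport M u v := by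
  intro h1
  have h2 := exp_eq_one_of_mem_plusSupport hM h h1 hθ
  have h3 : Complex.I * τ * (((θ + 1 : ℝ) : ℂ) - θ) = Complex.I * τ := by push_cast; ring
  rw [h3, hE] at h2
  norm_num at h2

theorem add_one_notMem_minusSupport (hE : Complex.exp (Complex.I * τ) = -1) {θ : ℝ}
    (hθ : θ ∈ minusSupport M u v) : θ + 1 ∉ minusSupport M u v := by
  intro h1
  have h2 := exp_eq_one_of_mem_minusSupport hM h h1 hθ
  have h3 : Complex.I * τ * (((θ + 1 : ℝ) : ℂ) - θ) = Complex.I * τ := by push_cast; ring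
  rw [h3, hE] at h2
  norm_num at h2

end PST

end Transfer

/-! ### Rationality of the eigenvalue support -/

section Rationality

variable {V : Type*} [Fintype V] [DecidableEq V]

/-- If `T` is the exact set of roots needed to annihilate `e_u`, then the monic polynomial with root
set `T` is rational. A `ℚ`-linear retraction `π : ℝ → ℚ`, applied to its coefficients, gives a
rational monic polynomial of the same degree that still annihilates `e_u`, because the entries of
the powers of `N` are rational; so it vanishes on `T`. -/
theorem exists_rational_polynomial {N : Matrix V V ℚ} {u : V} {T : Finset ℝ}
    (h0 : aeval (N.map (Rat.cast : ℚ → ℝ)) (∏ t ∈ T, (X - C t)) *ᵥ Pi.single u 1 = 0)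
    (h1 : ∀ t ∈ T, ∃ x : V → ℝ, x ᵥ* N.map (Rat.cast : ℚ → ℝ) = t • x ∧ x u ≠ 0) :
    ∃ q : ℚ[X], q.map (algebraMap ℚ ℝ) = ∏ t ∈ T, (X - C t) := by
  obtain ⟨π, hπ⟩ := (Algebra.linearMap ℚ ℝ).exists_leftInverse_of_injective
    (LinearMap.ker_eq_bot.2 (algebraMap ℚ ℝ).injective)
  have hπ' : ∀ r : ℚ, π (r : ℝ) = r := fun r => LinearMap.congr_fun hπ r
  set p : ℝ[X] := ∏ t ∈ T, (X - C t) with hp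
  have hpm : p.Monic := monic_prod_X_sub_C _ _
  have hpd : p.natDegree = T.card := by
    rw [hp, natDegree_prod_of_monic _ _ fun r _ => monic_X_sub_C r]; simp
  set q : ℚ[X] := ∑ k ∈ Finset.range (T.card + 1), monomial k (π (p.coeff k)) with hq
  refine ⟨q, ?_⟩
  have hpow : ∀ (k : ℕ) (i : V), ((N.map (Rat.cast : ℚ → ℝ)) ^ k) i u = ((N ^ k) i u : ℚ) := by
    intro k i
    have := Matrix.map_pow N (Rat.castHom ℝ) k
    exact (congrFun (congrFun this i) u).symm
  have hqN : aeval (N.map (Rat.cast : ℚ → ℝ)) (q.map (algebraMap ℚ ℝ)) *ᵥ Pi.single u 1 = 0 := by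
    ext i
    have h2 := congrFun h0 i
    rw [mulVec_single_one, col_apply, aeval_eq_sum_range, hpd, Matrix.sum_apply] at h2
    rw [mulVec_single_one, col_apply, hq, Polynomial.map_sum, map_sum, Matrix.sum_apply]
    simp only [map_monomial, aeval_monomial, Algebra.algebraMap_eq_smul_one, Matrix.smul_mul,
      Matrix.one_mul, Matrix.smul_apply, hpow, smul_eq_mul] at h2 ⊢
    have h3 := congrArg π h2
    simp only [map_sum, Pi.zero_apply, map_zero] at h3
    have h4 : ∀ k, π (p.coeff k * ((N ^ k) i u : ℚ)) = π (p.coeff k) * (N ^ k) i u := by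
      intro k
      rw [mul_comm, ← Rat.smul_def, map_smul, smul_eq_mul, mul_comm]
    simp only [h4] at h3
    have h5 := congrArg (algebraMap ℚ ℝ) h3
    simpa using h5
  refine eq_of_degree_sub_lt_of_eval_finset_eq T ?_ ?_
  · rw [degree_lt_iff_coeff_zero]
    intro k hk
    rw [coeff_sub, coeff_map, hq, finsetSum_coeff]
    simp only [coeff_monomial]
    rcases hk.eq_or_lt with rfl | hk
    · have h6 : p.coeff T.card = 1 := by rw [← hpd]; exact hpm
      have := hπ' 1
      simp only [Rat.cast_one] at this
      simp [h6, this]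
    · rw [coeff_eq_zero_of_natDegree_lt (p := p) (by omega)]
      simp; omega
  · intro t ht
    obtain ⟨x, hx, hxu⟩ := h1 t ht
    have h7 : x ⬝ᵥ (aeval (N.map (Rat.cast : ℚ → ℝ)) (q.map (algebraMap ℚ ℝ)) *ᵥ
      Pi.single u 1) = 0 := by rw [hqN, dotProduct_zero]
    rw [dotProduct_mulVec, vecMul_aeval_of_vecMul_eq hx, smul_dotProduct, dotProduct_single,
      mul_one, smul_eq_mul] at h7
    rw [(mul_eq_zero.1 h7).resolve_right hxu, hp, eval_prod, Finset.prod_eq_zero ht (by simp)]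

theorem exists_rat_eq_sum_of_map_eq {T : Finset ℝ} {q : ℚ[X]}
    (hq : q.map (algebraMap ℚ ℝ) = ∏ t ∈ T, (X - C t)) : ∃ r : ℚ, ∑ t ∈ T, t = r := by
  refine ⟨-q.nextCoeff, ?_⟩
  have h1 := prod_X_sub_C_nextCoeff (s := T) (fun t : ℝ => t)
  rw [← hq, nextCoeff_map (algebraMap ℚ ℝ).injective] at h1
  push_cast
  rw [show ((q.nextCoeff : ℚ) : ℝ) = algebraMap ℚ ℝ q.nextCoeff from rfl, h1, neg_neg]

/-- The image of the eigenvalue support under a rational polynomial `g` is the analogous root set for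
the matrix `g(N)`. -/
theorem exists_rational_polynomial_eigenvalueSupport {N : Matrix V V ℚ}
    (hM : (N.map (Rat.cast : ℚ → ℝ)).IsSymm) (u : V) (g : ℚ[X]) :
    ∃ q : ℚ[X], q.map (algebraMap ℚ ℝ) =
      ∏ t ∈ (eigenvalueSupport (N.map (Rat.cast : ℚ → ℝ)) u).image
        (fun θ => (g.map (algebraMap ℚ ℝ)).eval θ), (X - C t) := by
  set M := N.map (Rat.cast : ℚ → ℝ) with hMdef
  have hg : (aeval N g).map (Rat.cast : ℚ → ℝ) = aeval M (g.map (algebraMap ℚ ℝ)) := by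
    rw [aeval_map_algebraMap]
    exact (aeval_algHom_apply (AlgHom.mapMatrix (Algebra.ofId ℚ ℝ)) N g).symm
  refine exists_rational_polynomial (N := aeval N g) (u := u) ?_ ?_
  · rw [hg, ← aeval_comp]
    refine aeval_mulVec_eq_zero hM fun x θ hx hz => ?_
    rw [eval_comp, eval_prod]
    refine Finset.prod_eq_zero (Finset.mem_image_of_mem _ (mem_eigenvalueSupport.2
      ⟨x, hx, by simpa using hz⟩)) (by simp)
  · intro t ht
    obtain ⟨θ, hθ, rfl⟩ := Finset.mem_image.1 ht
    obtain ⟨x, hx, hu⟩ := mem_eigenvalueSupport.1 hθ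
    exact ⟨x, by rw [hg, vecMul_aeval_of_vecMul_eq (vecMul_eq_of_mulVec_eq hM hx)], hu⟩

theorem exists_int_eq_of_isIntegral_of_rat {x : ℝ} (hx : IsIntegral ℤ x) (hr : ∃ r : ℚ, x = r) :
    ∃ k : ℤ, x = k := by
  obtain ⟨r, rfl⟩ := hr
  have h1 : IsIntegral ℤ r :=
    (isIntegral_algebraMap_iff (algebraMap ℚ ℝ).injective).1 hx
  obtain ⟨k, hk⟩ := IsIntegrallyClosed.isIntegral_iff.1 h1
  exact ⟨k, by rw [← hk]; simp⟩

/-- The conjugation of `ℚ(δ)`, for `δ` a quadratic irrationality, maps roots of rational polynomials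
to roots. -/
theorem eval_conj_eq_zero {q : ℚ[X]} {a δ : ℝ} (ha : ∃ r : ℚ, a = r) (hδ : ∃ r : ℚ, δ ^ 2 = r)
    (hirr : ¬ ∃ r : ℚ, δ = r) (h : (q.map (algebraMap ℚ ℝ)).eval (a + δ) = 0) :
    (q.map (algebraMap ℚ ℝ)).eval (a - δ) = 0 := by
  obtain ⟨a, rfl⟩ := ha
  obtain ⟨D, hD⟩ := hδ
  have key : ∃ A B : ℚ, (q.map (algebraMap ℚ ℝ)).eval ((a : ℝ) + δ) = A + B * δ ∧
      (q.map (algebraMap ℚ ℝ)).eval ((a : ℝ) - δ) = A - B * δ := by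
    clear h
    induction q using Polynomial.induction_on with
    | C r => exact ⟨r, 0, by simp, by simp⟩
    | add p q hp hq =>
      obtain ⟨A, B, h1, h2⟩ := hp
      obtain ⟨A', B', h3, h4⟩ := hq
      refine ⟨A + A', B + B', ?_, ?_⟩
      · rw [Polynomial.map_add, eval_add, h1, h3]; push_cast; ring
      · rw [Polynomial.map_add, eval_add, h2, h4]; push_cast; ring
    | monomial k r ih =>
      obtain ⟨A, B, h1, h2⟩ := ih
      refine ⟨A * a + B * D, A + B * a, ?_, ?_⟩
      · rw [pow_succ, ← mul_assoc, Polynomial.map_mul, eval_mul, h1, map_X, eval_X]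
        push_cast; rw [← hD]; ring
      · rw [pow_succ, ← mul_assoc, Polynomial.map_mul, eval_mul, h2, map_X, eval_X]
        push_cast; rw [← hD]; ring
  obtain ⟨A, B, h1, h2⟩ := key
  rw [h1] at h
  have hB : B = 0 := by
    by_contra hB
    refine hirr ⟨-A / B, ?_⟩
    have : (B : ℝ) ≠ 0 := by exact_mod_cast hB
    push_cast
    rw [eq_div_iff this]; linarith
  rw [h2]
  simp only [hB, Rat.cast_zero, zero_mul, add_zero, sub_zero] at h ⊢
  exact h

end Rationality

/-! ### Arithmetic of eigenvalue supports -/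

section Arithmetic

/-- The elements of `S` are integer multiples of `π / τ`, and their sum is rational and, unless
`S = {0}`, positive. So `π / τ` is rational. -/
theorem forall_int_of_zero_mem {S : Finset ℝ} {τ : ℝ} (hτ : 0 < τ)
    (hsum : ∃ r : ℚ, ∑ θ ∈ S, θ = r) (h0 : (0 : ℝ) ∈ S) (hnonneg : ∀ θ ∈ S, 0 ≤ θ)
    (hint : ∀ θ ∈ S, IsIntegral ℤ θ)
    (hdiff : ∀ θ ∈ S, ∀ θ' ∈ S, ∃ k : ℤ, τ * (θ - θ') = k * Real.pi) :
    ∀ θ ∈ S, ∃ k : ℤ, θ = k := by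
  choose! k hk using fun θ (hθ : θ ∈ S) => hdiff θ hθ 0 h0
  obtain ⟨r, hr⟩ := hsum
  intro θ hθ
  refine exists_int_eq_of_isIntegral_of_rat (hint θ hθ) ?_
  rcases (hnonneg θ hθ).eq_or_lt with h1 | h1
  · exact ⟨0, by simp [← h1]⟩
  have hpi := Real.pi_pos
  have hsum : τ * r = (∑ θ ∈ S, k θ : ℤ) * Real.pi := by
    rw [← hr, Finset.mul_sum, Int.cast_sum, Finset.sum_mul]
    exact Finset.sum_congr rfl fun θ hθ => by rw [← hk θ hθ, sub_zero]
  have hpos : 0 < ∑ θ ∈ S, θ := Finset.sum_pos' hnonneg ⟨θ, hθ, h1⟩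
  set K : ℤ := ∑ θ ∈ S, k θ
  have hK : (K : ℝ) ≠ 0 := by
    intro hK
    rw [hr] at hpos
    rw [hK, zero_mul] at hsum
    exact (mul_pos hτ hpos).ne' hsum
  refine ⟨k θ * r / K, ?_⟩
  push_cast
  rw [eq_div_iff hK]
  have h2 := hk θ hθ
  rw [sub_zero] at h2
  refine mul_left_cancel₀ (mul_pos hτ hpi).ne' ?_
  linear_combination (K * Real.pi) * h2 - (k θ * Real.pi) * hsum

theorem exists_sq_eq_of_mul_sq_eq_sq {k m l : ℤ} (hm : m ≠ 0) (h : k * m ^ 2 = l ^ 2) :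
    ∃ c : ℤ, k = c ^ 2 := by
  obtain ⟨c, rfl⟩ := (Int.pow_dvd_pow_iff two_ne_zero).1 (Dvd.intro_left k h)
  refine ⟨c, ?_⟩
  have : m ^ 2 ≠ 0 := pow_ne_zero _ hm
  refine mul_right_cancel₀ this ?_
  rw [h]; ring

/-- Two conjugate pairs `θ`, `2a - θ` and `μ`, `2a - μ` of quadratic integers in the same field
cannot satisfy `θ, 2a - θ < 4 < μ ≤ 2a`: the bounds force trace `5` and norm `5` on the first
pair, so that the field is `ℚ(√5)`, while the discriminant of the second pair is one of `25`, `21`,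
`17`, `13`. -/
theorem quadratic_conjugates_bounded {a η θ μ : ℝ} {m l : ℤ}
    (hθ : θ = a + m * η) (hμ : μ = a + l * η) (hirr : ¬ ∃ r : ℚ, η = r)
    (ha : ∃ A : ℤ, 2 * a = A) (hP : ∃ P : ℤ, θ * (2 * a - θ) = P)
    (hP' : ∃ P : ℤ, μ * (2 * a - μ) = P) (hm : m ≠ 0)
    (h1 : θ < 4) (h2 : 2 * a - θ < 4) (h3 : 4 < μ) (h4 : 0 ≤ 2 * a - μ) : False := by
  obtain ⟨A, hA⟩ := ha
  obtain ⟨P, hP⟩ := hP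
  obtain ⟨P', hP'⟩ := hP'
  have hη : η ≠ 0 := fun h => hirr ⟨0, by simp [h]⟩
  have hm' : (m : ℝ) ≠ 0 := by exact_mod_cast hm
  rw [hA] at hP hP' h2 h4
  have hA1 : 4 < A := by
    have : (4 : ℝ) < A := by linarith
    exact_mod_cast this
  have hA2 : A < 8 := by
    have : (A : ℝ) < 8 := by linarith
    exact_mod_cast this
  have hP1 : 4 * A - 16 < P := by
    have : (4 * A - 16 : ℝ) < P := by nlinarith
    exact_mod_cast this
  have hsq : (A : ℝ) ^ 2 - 4 * P = 4 * m ^ 2 * η ^ 2 := by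
    rw [← hP, ← hA, hθ]; ring
  have hsq' : (A : ℝ) ^ 2 - 4 * P' = 4 * l ^ 2 * η ^ 2 := by
    rw [← hP', ← hA, hμ]; ring
  have hP2 : 4 * P < A ^ 2 := by
    have : (4 * P : ℝ) < A ^ 2 := by
      have : 0 < 4 * (m : ℝ) ^ 2 * η ^ 2 := by positivity
      linarith
    exact_mod_cast this
  -- The traces `6` and `7` leave no room between the two bounds on the norm `P`.
  have hA5 : A = 5 := by
    obtain h | h | h : A = 5 ∨ A = 6 ∨ A = 7 := by omega
    · exact h
    · subst h; omega
    · subst h; omega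
  subst hA5
  norm_num at hP1 hP2 hP hP' hA h2 h4 hsq hsq'
  have hPc : P = 5 := by
    obtain h | h : P = 5 ∨ P = 6 := by omega
    · exact h
    · exfalso
      subst h
      have hfac : (θ - 2) * (θ - 3) = 0 := by push_cast at hP; linarith
      refine hirr ?_
      rcases mul_eq_zero.1 hfac with h5 | h5
      · refine ⟨-1 / (2 * m), ?_⟩
        push_cast; rw [eq_div_iff (by positivity)]; linarith
      · refine ⟨1 / (2 * m), ?_⟩
        push_cast; rw [eq_div_iff (by positivity)]; linarith
  subst hPc
  have hP'1 : 0 ≤ P' := by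
    have : (0 : ℝ) ≤ P' := by rw [← hP']; exact mul_nonneg (by linarith) (by linarith)
    exact_mod_cast this
  have hP'2 : P' < 4 := by
    have : (P' : ℝ) < 4 := by nlinarith
    exact_mod_cast this
  have hrel : 5 * (25 - 4 * P') * m ^ 2 = (5 * l) ^ 2 := by
    have : (5 * (25 - 4 * P') * m ^ 2 : ℝ) = (5 * l) ^ 2 := by
      refine mul_right_cancel₀ (pow_ne_zero 2 hη) ?_
      push_cast at hsq
      linear_combination 5 * (m : ℝ) ^ 2 * η ^ 2 * hsq' - 5 * l ^ 2 * η ^ 2 * hsq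
    exact_mod_cast this
  -- None of `5 * (25 - 4 * P')` for `0 ≤ P' < 4` is a square.
  obtain ⟨c, hc⟩ := exists_sq_eq_of_mul_sq_eq_sq hm hrel
  have hc1 : c ≤ 11 := by nlinarith
  have hc2 : -11 ≤ c := by nlinarith
  interval_cases c <;> omega

/-- With `a` the mean of `S` and `η = π / (τ |S|)`, each element of `S` is `a + m η` with `m` an
integer, and rationality of the sum of the distinct values of `(θ - a)²` makes `η²` rational.
If `η` is irrational, then `S ⊆ {μ, 2a - μ, a}` for the element `μ > 4`. -/
theorem forall_int_or_card_le_three {S : Finset ℝ} {τ : ℝ} (hτ : 0 < τ)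
    (hrat : ∀ g : ℚ[X], ∃ q : ℚ[X], q.map (algebraMap ℚ ℝ) =
      ∏ t ∈ S.image (fun θ => (g.map (algebraMap ℚ ℝ)).eval θ), (X - C t))
    (hint : ∀ θ ∈ S, IsIntegral ℤ θ)
    (hdiff : ∀ θ ∈ S, ∀ θ' ∈ S, ∃ k : ℤ, τ * (θ - θ') = k * Real.pi)
    (hnonneg : ∀ θ ∈ S, 0 ≤ θ) (hfour : (4 : ℝ) ∉ S)
    (huniq : ∀ θ ∈ S, ∀ θ' ∈ S, 4 < θ → 4 < θ' → θ = θ') (hex : ∃ μ ∈ S, 4 < μ) :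
    (∀ θ ∈ S, ∃ k : ℤ, θ = k) ∨ ∃ R : Finset ℝ, R.card ≤ 3 ∧ S ⊆ R := by
  obtain ⟨μ, hμS, hμ⟩ := hex
  have hN : (S.card : ℝ) ≠ 0 := by
    exact_mod_cast (Finset.card_pos.2 ⟨μ, hμS⟩).ne'
  obtain ⟨q, hq⟩ := hrat X
  simp only [map_X, eval_X, Finset.image_id'] at hq
  obtain ⟨a, ha⟩ : ∃ a : ℚ, ∑ θ ∈ S, θ = S.card * (a : ℝ) := by
    obtain ⟨r, hr⟩ := exists_rat_eq_sum_of_map_eq hq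
    refine ⟨r / S.card, ?_⟩
    rw [hr]; push_cast; field_simp
  set η : ℝ := Real.pi / (τ * S.card) with hη
  have hη0 : η ≠ 0 := div_ne_zero Real.pi_pos.ne' (mul_ne_zero hτ.ne' hN)
  have hm : ∀ θ ∈ S, ∃ m : ℤ, θ = a + m * η := by
    intro θ hθ
    choose! k hk using hdiff θ hθ
    refine ⟨∑ θ' ∈ S, k θ', ?_⟩
    have h1 : τ * (S.card * θ - ∑ θ' ∈ S, θ') = (∑ θ' ∈ S, k θ' : ℤ) * Real.pi := by
      rw [Int.cast_sum, Finset.sum_mul, ← Finset.sum_congr rfl hk, ← Finset.mul_sum,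
        Finset.sum_sub_distrib, Finset.sum_const, nsmul_eq_mul]
    rw [ha] at h1
    rw [hη]
    field_simp
    linarith
  by_cases hall : ∀ θ ∈ S, θ = a
  · exact Or.inr ⟨{(a : ℝ)}, by simp, fun θ hθ => by simp [hall θ hθ]⟩
  push Not at hall
  obtain ⟨θ₀, hθ₀, hθ₀a⟩ := hall
  have hηsq : ∃ r : ℚ, η ^ 2 = r := by
    obtain ⟨q2, hq2⟩ := hrat ((X - C a) ^ 2)
    obtain ⟨r, hr⟩ := exists_rat_eq_sum_of_map_eq hq2
    set T := S.image fun θ => (((X - C a) ^ 2 : ℚ[X]).map (algebraMap ℚ ℝ)).eval θ with hT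
    have hT1 : ∀ t ∈ T, ∃ k : ℤ, t = k * η ^ 2 := by
      intro t ht
      obtain ⟨θ, hθ, rfl⟩ := Finset.mem_image.1 ht
      obtain ⟨m, hm⟩ := hm θ hθ
      refine ⟨m ^ 2, ?_⟩
      simp only [Polynomial.map_pow, Polynomial.map_sub, map_X, map_C, eval_pow, eval_sub, eval_X,
        eval_C, eq_ratCast]
      rw [hm]; push_cast; ring
    have hT2 : 0 < ∑ t ∈ T, t := by
      refine Finset.sum_pos' ?_ ⟨_, Finset.mem_image_of_mem _ hθ₀, ?_⟩
      · intro t ht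
        obtain ⟨θ, hθ, rfl⟩ := Finset.mem_image.1 ht
        simp only [Polynomial.map_pow, eval_pow]
        positivity
      · have : θ₀ - a ≠ 0 := sub_ne_zero.2 hθ₀a
        simp only [Polynomial.map_pow, Polynomial.map_sub, map_X, map_C, eval_pow, eval_sub, eval_X,
          eval_C, eq_ratCast]
        positivity
    choose! k hk using hT1
    have h1 : (r : ℝ) = (∑ t ∈ T, k t : ℤ) * η ^ 2 := by
      rw [← hr, Int.cast_sum, Finset.sum_mul]
      exact Finset.sum_congr rfl hk
    rw [hr] at hT2
    have h2 : ((∑ t ∈ T, k t : ℤ) : ℝ) ≠ 0 := by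
      intro h0
      rw [h0, zero_mul] at h1
      exact hT2.ne' h1
    refine ⟨r / (∑ t ∈ T, k t : ℤ), ?_⟩
    rw [Rat.cast_div, Rat.cast_intCast, h1]
    field_simp
  -- If `η` is rational, then so are all elements of `S`.
  by_cases hirr : ∃ r : ℚ, η = r
  · left
    intro θ hθ
    refine exists_int_eq_of_isIntegral_of_rat (hint θ hθ) ?_
    obtain ⟨m, hm⟩ := hm θ hθ
    obtain ⟨r, hr⟩ := hirr
    exact ⟨a + m * r, by rw [hm, hr]; push_cast; ring⟩
  right
  obtain ⟨D, hD⟩ := hηsq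
  have hconj : ∀ θ ∈ S, θ ≠ a → 2 * a - θ ∈ S := by
    intro θ hθ hne
    obtain ⟨m, hmθ⟩ := hm θ hθ
    have hm0 : (m : ℝ) ≠ 0 := fun h0 => hne (by rw [hmθ, h0]; ring)
    have h1 : (q.map (algebraMap ℚ ℝ)).eval ((a : ℝ) + m * η) = 0 := by
      rw [hq, eval_prod, Finset.prod_eq_zero hθ]
      rw [← hmθ]; simp
    have h2 := eval_conj_eq_zero ⟨a, rfl⟩ ⟨m ^ 2 * D, by rw [mul_pow, hD]; push_cast; ring⟩
      (fun ⟨r, hr⟩ => hirr ⟨r / m, by push_cast; rw [← hr]; field_simp⟩) h1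
    rw [hq, eval_prod, Finset.prod_eq_zero_iff] at h2
    obtain ⟨s, hs, h3⟩ := h2
    rw [eval_sub, eval_X, eval_C, sub_eq_zero] at h3
    have : 2 * a - θ = s := by rw [← h3, hmθ]; ring
    rwa [this]
  -- The norm of a conjugate pair is rational and integral.
  have hprod : ∀ θ ∈ S, θ ≠ a → ∃ P : ℤ, θ * (2 * a - θ) = P := by
    intro θ hθ hne
    refine exists_int_eq_of_isIntegral_of_rat ((hint θ hθ).mul (hint _ (hconj θ hθ hne))) ?_
    obtain ⟨m, hmθ⟩ := hm θ hθ
    exact ⟨a ^ 2 - m ^ 2 * D, by push_cast; rw [← hD, hmθ]; ring⟩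
  refine ⟨{μ, 2 * a - μ, (a : ℝ)}, Finset.card_le_three, ?_⟩
  intro θ hθ
  by_contra hcon
  simp only [Finset.mem_insert, Finset.mem_singleton, not_or] at hcon
  obtain ⟨hθμ, hθμ', hθa⟩ := hcon
  have hlt : ∀ θ ∈ S, θ ≠ μ → θ < 4 := by
    intro θ hθ hne
    rcases lt_trichotomy θ 4 with h | h | h
    · exact h
    · exact absurd (h ▸ hθ) hfour
    · exact absurd (huniq θ hθ μ hμS h hμ) hne
  have hθ' := hconj θ hθ hθa
  have h1 := hlt θ hθ hθμ
  have h2 := hlt _ hθ' fun h => hθμ' (by linarith)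
  have hμa : μ ≠ a := by
    rintro h
    rw [← h] at h2
    linarith
  obtain ⟨m, hmθ⟩ := hm θ hθ
  obtain ⟨l, hlμ⟩ := hm μ hμS
  refine quadratic_conjugates_bounded hmθ hlμ hirr ?_ (hprod θ hθ hθa) (hprod μ hμS hμa) ?_ h1 h2 hμ
    (hnonneg _ (hconj μ hμS hμa))
  · refine exists_int_eq_of_isIntegral_of_rat ?_ ⟨2 * a, by push_cast; ring⟩
    have := (hint θ hθ).add (hint _ hθ')
    rwa [add_sub_cancel] at this
  · rintro rfl
    exact hθa (by rw [hmθ]; simp)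

/-- `T` contains at most one element of each of `{0, 1}` and `{2, 3}`. -/
theorem exists_pair_of_forall_add_one_notMem {T : Finset ℝ}
    (hT : ∀ t ∈ T, t = 0 ∨ t = 1 ∨ t = 2 ∨ t = 3 ∨ t = 4) (h : ∀ t ∈ T, t + 1 ∉ T) :
    ∃ a b : ℝ, T ⊆ {a, b, 4} := by
  have h01 : (0 : ℝ) ∈ T → (1 : ℝ) ∉ T := fun h0 h1 => h 0 h0 (by norm_num [h1])
  have h23 : (2 : ℝ) ∈ T → (3 : ℝ) ∉ T := fun h0 h1 => h 2 h0 (by norm_num [h1])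
  classical
  refine ⟨if (0 : ℝ) ∈ T then 0 else 1, if (2 : ℝ) ∈ T then 2 else 3, fun t ht => ?_⟩
  simp only [Finset.mem_insert, Finset.mem_singleton]
  rcases hT t ht with rfl | rfl | rfl | rfl | rfl
  · simp [ht]
  · left; rw [if_neg fun h0 => h01 h0 ht]
  · simp [ht]
  · right; left; rw [if_neg fun h0 => h23 h0 ht]
  · simp

end Arithmetic

/-! ### The Laplacians of the perturbed cycle and their eigenvalues -/

section PerturbedCycle

variable {n : ℕ}

theorem natCast_zmod_ne_zero {k : ℕ} (h0 : 0 < k) (hk : k < n) : (k : ZMod n) ≠ 0 := by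
  rw [Ne, ZMod.natCast_eq_zero_iff]
  exact fun h => absurd (Nat.le_of_dvd h0 h) (by omega)

/-- The common form of the Laplacian (`ε = -1`) and the signless Laplacian (`ε = 1`) of the cycle
with an additional edge of weight `ρ` between `0` and `b`: that of the cycle plus `ρ χ χᵀ`, where
`χ = e₀ + ε e_b`. -/
def perturbedCycleMatrix (n : ℕ) (b : ZMod n) (ε ρ : ℝ) : Matrix (ZMod n) (ZMod n) ℝ :=
  Matrix.of fun i j => (if i = j then 2 else 0) +
    ε * ((if i = j + 1 then 1 else 0) + (if j = i + 1 then 1 else 0)) +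
    ρ * (((if i = 0 then 1 else 0) + ε * if i = b then 1 else 0) *
      ((if j = 0 then 1 else 0) + ε * if j = b then 1 else 0))

theorem perturbedCycleMatrix_isSymm (b : ZMod n) (ε ρ : ℝ) :
    (perturbedCycleMatrix n b ε ρ).IsSymm := by
  ext i j
  simp only [perturbedCycleMatrix, transpose_apply, of_apply, eq_comm (a := j) (b := i)]
  ring

theorem perturbedCycleMatrix_eq_map_intCast (b : ZMod n) (ε ρ : ℤ) :
    ∃ Z : Matrix (ZMod n) (ZMod n) ℤ, perturbedCycleMatrix n b ε ρ = Z.map Int.cast := by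
  refine ⟨Matrix.of fun i j => (if i = j then 2 else 0) +
    ε * ((if i = j + 1 then 1 else 0) + (if j = i + 1 then 1 else 0)) +
    ρ * (((if i = 0 then 1 else 0) + ε * if i = b then 1 else 0) *
      ((if j = 0 then 1 else 0) + ε * if j = b then 1 else 0)), ?_⟩
  ext i j
  simp [perturbedCycleMatrix]

theorem edgePerturbedCycle_weight (hn : 3 ≤ n) (b : ZMod n) (hb : b ≠ 0) (ρ : ℝ) (hρ : 0 < ρ)
    (i j : ZMod n) : (edgePerturbedCycle n b hb ρ hρ).adjMatrix i j =
      ((if i = j + 1 then 1 else 0) + (if j = i + 1 then 1 else 0)) +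
      ρ * ((if i = 0 then 1 else 0) * (if j = b then 1 else 0) +
        (if i = b then 1 else 0) * (if j = 0 then 1 else 0)) := by
  have h1 : (1 : ZMod n) ≠ 0 := by exact_mod_cast natCast_zmod_ne_zero one_pos (by omega : 1 < n)
  have h2 : (2 : ZMod n) ≠ 0 := by exact_mod_cast natCast_zmod_ne_zero two_pos (by omega : 2 < n)
  have hadj : (cycleZMod n).Adj i j ↔ i = j + 1 ∨ j = i + 1 := by
    change (i ≠ j ∧ (i - j = 1 ∨ i - j = -1)) ↔ _
    constructor
    · rintro ⟨-, h | h⟩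
      · left; linear_combination h
      · right; linear_combination -h
    · rintro (h | h)
      · exact ⟨fun h0 => h1 (by linear_combination h0 - h), Or.inl (by linear_combination h)⟩
      · exact ⟨fun h0 => h1 (by linear_combination -h0 - h), Or.inr (by linear_combination -h)⟩
  have hcyc : (WeightedGraph.ofSimpleGraph (cycleZMod n)).weight i j =
      (if i = j + 1 then 1 else 0) + (if j = i + 1 then 1 else 0) := by
    simp only [WeightedGraph.ofSimpleGraph, hadj]
    by_cases h3 : i = j + 1 <;> by_cases h4 : j = i + 1
    · exact absurd (by linear_combination -h3 - h4) h2
    · rw [if_pos (Or.inl h3), if_pos h3, if_neg h4, add_zero]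
    · rw [if_pos (Or.inr h4), if_neg h3, if_pos h4, zero_add]
    · simp [h3, h4]
  have hchord : (if (i = 0 ∧ j = b) ∨ (i = b ∧ j = 0) then ρ else 0) =
      ρ * ((if i = 0 then 1 else 0) * (if j = b then 1 else 0) +
        (if i = b then 1 else 0) * (if j = 0 then 1 else 0)) := by
    by_cases h3 : i = 0 <;> by_cases h4 : j = b <;> by_cases h5 : i = b <;> by_cases h6 : j = 0 <;>
      simp_all
  rw [← hcyc, ← hchord]
  rfl

theorem edgePerturbedCycle_degree [NeZero n] (hn : 3 ≤ n) (b : ZMod n) (hb : b ≠ 0) (ρ : ℝ)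
    (hρ : 0 < ρ) (i : ZMod n) : ∑ j, (edgePerturbedCycle n b hb ρ hρ).adjMatrix i j =
      2 + ρ * ((if i = 0 then 1 else 0) + (if i = b then 1 else 0)) := by
  simp only [edgePerturbedCycle_weight hn, Finset.sum_add_distrib, ← Finset.mul_sum]
  have h1 : ∀ j : ZMod n, i = j + 1 ↔ i - 1 = j := fun j =>
    ⟨fun h => by rw [h]; ring, fun h => by rw [← h]; ring⟩
  simp only [h1, Finset.sum_ite_eq, Finset.sum_ite_eq', Finset.mem_univ, if_true]
  ring

theorem laplacian_eq [NeZero n] (hn : 3 ≤ n) (b : ZMod n) (hb : b ≠ 0) (ρ : ℝ) (hρ : 0 < ρ) :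
    (edgePerturbedCycle n b hb ρ hρ).laplacian = perturbedCycleMatrix n b (-1) ρ := by
  ext i j
  rw [WeightedGraph.laplacian, WeightedGraph.degMatrix, Matrix.sub_apply, diagonal_apply,
    edgePerturbedCycle_degree hn, edgePerturbedCycle_weight hn, perturbedCycleMatrix, of_apply]
  by_cases h : i = j
  · subst h
    by_cases h1 : i = 0 <;> by_cases h2 : i = b <;> simp_all <;> ring
  · by_cases h1 : i = 0 <;> by_cases h2 : i = b <;> by_cases h3 : j = 0 <;> by_cases h4 : j = b <;>
      simp_all <;> ring

theorem signlessLaplacian_eq [NeZero n] (hn : 3 ≤ n) (b : ZMod n) (hb : b ≠ 0) (ρ : ℝ)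
    (hρ : 0 < ρ) :
    (edgePerturbedCycle n b hb ρ hρ).signlessLaplacian = perturbedCycleMatrix n b 1 ρ := by
  ext i j
  rw [WeightedGraph.signlessLaplacian, WeightedGraph.degMatrix, Matrix.add_apply, diagonal_apply,
    edgePerturbedCycle_degree hn, edgePerturbedCycle_weight hn, perturbedCycleMatrix, of_apply]
  by_cases h : i = j
  · subst h
    by_cases h1 : i = 0 <;> by_cases h2 : i = b <;> simp_all <;> ring
  · by_cases h1 : i = 0 <;> by_cases h2 : i = b <;> by_cases h3 : j = 0 <;> by_cases h4 : j = b <;>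
      simp_all

variable [NeZero n]

theorem perturbedCycleMatrix_mulVec (b : ZMod n) (ε ρ : ℝ) (x : ZMod n → ℝ) (i : ZMod n) :
    (perturbedCycleMatrix n b ε ρ *ᵥ x) i = 2 * x i + ε * (x (i - 1) + x (i + 1)) +
      ρ * ((if i = 0 then 1 else 0) + ε * if i = b then 1 else 0) * (x 0 + ε * x b) := by
  have h1 : ∀ j : ZMod n, i = j + 1 ↔ i - 1 = j := fun j =>
    ⟨fun h => by rw [h]; ring, fun h => by rw [← h]; ring⟩
  simp only [perturbedCycleMatrix, mulVec, dotProduct, of_apply, h1]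
  simp only [add_mul, mul_add, Finset.sum_add_distrib, mul_assoc, ite_mul, mul_ite, one_mul,
    zero_mul, mul_zero, mul_one, Finset.sum_ite_eq, Finset.sum_ite_eq', Finset.mem_univ, if_true]

theorem dotProduct_perturbedCycleMatrix_mulVec (b : ZMod n) {ε : ℝ} (hε : ε ^ 2 = 1) (ρ : ℝ)
    (x : ZMod n → ℝ) :
    x ⬝ᵥ (perturbedCycleMatrix n b ε ρ *ᵥ x) =
      ∑ i, (x i + ε * x (i + 1)) ^ 2 + ρ * (x 0 + ε * x b) ^ 2 := by
  have hs1 : ∑ i : ZMod n, x (i + 1) ^ 2 = ∑ i, x i ^ 2 :=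
    Equiv.sum_comp (Equiv.addRight (1 : ZMod n)) fun i => x i ^ 2
  have hs2 : ∑ i : ZMod n, x i * x (i - 1) = ∑ i, x (i + 1) * x i := by
    rw [← Equiv.sum_comp (Equiv.addRight (1 : ZMod n)) fun i => x i * x (i - 1)]
    simp
  have hL : ∀ i, x i * (perturbedCycleMatrix n b ε ρ *ᵥ x) i =
      2 * x i ^ 2 + ε * (x i * x (i - 1)) + ε * (x (i + 1) * x i) +
      ρ * (x 0 + ε * x b) * ((if i = 0 then x i else 0) + ε * if i = b then x i else 0) := by
    intro i
    rw [perturbedCycleMatrix_mulVec]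
    split_ifs <;> ring
  have hR : ∀ i, (x i + ε * x (i + 1)) ^ 2 =
      x i ^ 2 + x (i + 1) ^ 2 + 2 * ε * (x (i + 1) * x i) := by
    intro i; linear_combination x (i + 1) ^ 2 * hε
  simp only [dotProduct, hL, hR, Finset.sum_add_distrib, ← Finset.mul_sum, hs1, hs2,
    Finset.sum_ite_eq', Finset.mem_univ, if_true]
  ring

theorem dotProduct_self_pos_of_ne_zero {x : ZMod n → ℝ} (hx : x ≠ 0) : 0 < x ⬝ᵥ x :=
  lt_of_le_of_ne (by simpa using dotProduct_self_star_nonneg x)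
    fun h => hx (dotProduct_self_eq_zero.1 h.symm)

section Eigenvalues

variable {b : ZMod n} {ε ρ : ℝ} (hε : ε ^ 2 = 1) (hρ : 0 < ρ)

include hε

/-- On the kernel of the rank-one perturbation, the form is bounded by that of the unperturbed cycle. -/
theorem dotProduct_mulVec_le_four_mul {x : ZMod n → ℝ} (h : x 0 + ε * x b = 0) :
    x ⬝ᵥ (perturbedCycleMatrix n b ε ρ *ᵥ x) ≤ 4 * (x ⬝ᵥ x) := by
  have hs1 : ∑ i : ZMod n, x (i + 1) * x (i + 1) = ∑ i, x i * x i :=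
    Equiv.sum_comp (Equiv.addRight (1 : ZMod n)) fun i => x i * x i
  rw [dotProduct_perturbedCycleMatrix_mulVec b hε, h]
  have h1 : ∑ i : ZMod n, (x i + ε * x (i + 1)) ^ 2 ≤
      ∑ i, (2 * (x i * x i) + 2 * (x (i + 1) * x (i + 1))) :=
    Finset.sum_le_sum fun i _ => by nlinarith [sq_nonneg (x i - ε * x (i + 1))]
  rw [Finset.sum_add_distrib, ← Finset.mul_sum, ← Finset.mul_sum, hs1] at h1
  simp only [dotProduct]
  linarith

/-- The span of two orthogonal eigenvectors would contain a nonzero vector on which the rank-one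
perturbation vanishes. -/
theorem eigenvalue_unique_of_four_lt {x y : ZMod n → ℝ} {θ θ' : ℝ} (hx0 : x ≠ 0) (hy0 : y ≠ 0)
    (hx : perturbedCycleMatrix n b ε ρ *ᵥ x = θ • x)
    (hy : perturbedCycleMatrix n b ε ρ *ᵥ y = θ' • y) (hθ : 4 < θ) (hθ' : 4 < θ') : θ = θ' := by
  by_contra hne
  have horth := dotProduct_eigenvector_eq_zero (perturbedCycleMatrix_isSymm b ε ρ) hx hy hne
  have hxx := dotProduct_self_pos_of_ne_zero hx0
  have hyy := dotProduct_self_pos_of_ne_zero hy0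
  set α := x 0 + ε * x b with hα
  set β := y 0 + ε * y b with hβ
  have hα0 : α ≠ 0 := by
    intro h0
    have h1 := dotProduct_mulVec_le_four_mul hε (ρ := ρ) (hα.symm.trans h0)
    rw [hx, dotProduct_smul, smul_eq_mul] at h1
    nlinarith
  have h1 := dotProduct_mulVec_le_four_mul hε (ρ := ρ) (b := b) (x := β • x - α • y) (by
    simp only [Pi.sub_apply, Pi.smul_apply, smul_eq_mul]
    linear_combination α * hβ - β * hα)
  have horth' : y ⬝ᵥ x = 0 := by rw [dotProduct_comm, horth]
  simp only [mulVec_sub, mulVec_smul, hx, hy, dotProduct_sub, sub_dotProduct, dotProduct_smul,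
    smul_dotProduct, horth, horth', smul_eq_mul, mul_zero, sub_zero, zero_sub] at h1
  have h2 : 0 < α ^ 2 := by positivity
  nlinarith [mul_nonneg (mul_nonneg (sq_nonneg β) hxx.le) (sub_pos.2 hθ).le,
    mul_pos (mul_pos h2 hyy) (sub_pos.2 hθ')]

include hρ

theorem eigenvalue_nonneg {x : ZMod n → ℝ} {θ : ℝ} (hx0 : x ≠ 0)
    (hx : perturbedCycleMatrix n b ε ρ *ᵥ x = θ • x) : 0 ≤ θ := by
  have h1 := dotProduct_perturbedCycleMatrix_mulVec b hε ρ x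
  rw [hx, dotProduct_smul, smul_eq_mul] at h1
  have h2 : 0 ≤ ∑ i : ZMod n, (x i + ε * x (i + 1)) ^ 2 := Finset.sum_nonneg fun i _ => sq_nonneg _
  have h3 : 0 ≤ ρ * (x 0 + ε * x b) ^ 2 := by positivity
  exact nonneg_of_mul_nonneg_left (by linarith) (dotProduct_self_pos_of_ne_zero hx0)

end Eigenvalues

theorem apply_eq_apply_zero_of_forall_add_one_eq {x : ZMod n → ℝ} (h : ∀ i, x (i + 1) = x i) (i : ZMod n) :
    x i = x 0 := by
  have : ∀ k : ℕ, x (k : ZMod n) = x 0 := by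
    intro k
    induction k with
    | zero => simp
    | succ k ih => rw [Nat.cast_succ, h, ih]
  rw [← ZMod.natCast_zmod_val i]
  exact this _

theorem eigenvalue_ne_four {b : ZMod n} {ρ : ℝ} (hρ : 0 < ρ) {x : ZMod n → ℝ} {θ : ℝ} (hx0 : x ≠ 0)
    (hx : perturbedCycleMatrix n b 1 ρ *ᵥ x = θ • x) : θ ≠ 4 := by
  rintro rfl
  have hs1 : ∑ i : ZMod n, x (i + 1) = ∑ i, x i := Equiv.sum_comp (Equiv.addRight (1 : ZMod n)) x
  have hs2 : ∑ i : ZMod n, x (i - 1) = ∑ i, x i := Equiv.sum_comp (Equiv.subRight (1 : ZMod n)) x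
  have hs3 : ∑ i : ZMod n, x (i + 1) ^ 2 = ∑ i, x i ^ 2 :=
    Equiv.sum_comp (Equiv.addRight (1 : ZMod n)) fun i => x i ^ 2
  -- Sum the eigenvalue equation over all vertices.
  have h0 : x 0 + x b = 0 := by
    have h1 : ∑ i, (perturbedCycleMatrix n b 1 ρ *ᵥ x) i = ∑ i, 4 * x i := by rw [hx]; simp
    simp only [perturbedCycleMatrix_mulVec, one_mul, Finset.sum_add_distrib, ← Finset.mul_sum,
      ← Finset.sum_mul, hs1, hs2, Finset.sum_ite_eq', Finset.mem_univ, if_true] at h1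
    have h2 : ρ * (x 0 + x b) = 0 := by linarith
    exact (mul_eq_zero.1 h2).resolve_left hρ.ne'
  have h1 := dotProduct_perturbedCycleMatrix_mulVec b (one_pow 2) ρ x
  rw [hx, dotProduct_smul, smul_eq_mul, one_mul, h0] at h1
  have h2 : ∑ i : ZMod n, (x (i + 1) - x i) ^ 2 = 0 := by
    have h3 : ∑ i : ZMod n, (x (i + 1) - x i) ^ 2 =
        ∑ i, (2 * x (i + 1) ^ 2 + 2 * x i ^ 2 - (x i + 1 * x (i + 1)) ^ 2) :=
      Finset.sum_congr rfl fun i _ => by ring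
    rw [h3, Finset.sum_sub_distrib, Finset.sum_add_distrib, ← Finset.mul_sum, ← Finset.mul_sum, hs3]
    simp only [dotProduct, ← pow_two] at h1
    linarith
  have h3 := (Finset.sum_eq_zero_iff_of_nonneg fun i _ => sq_nonneg _).1 h2
  have h4 := apply_eq_apply_zero_of_forall_add_one_eq (x := x) fun i =>
    sub_eq_zero.1 (pow_eq_zero_iff two_ne_zero |>.1 (h3 i (Finset.mem_univ i)))
  refine hx0 (funext fun i => ?_)
  rw [h4 b] at h0
  rw [h4 i]
  simp only [Pi.zero_apply]
  linarith

end PerturbedCycle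

/-! ### A nowhere vanishing eigenvector of the signless Laplacian -/

section Perron

variable {n : ℕ} [NeZero n]

/-- The Perron eigenvector. The matrix and its largest eigenvalue `μ` make `μ - K` positive
semidefinite, and the absolute value of a maximizing vector lies in its kernel as well. The bound
`4 < μ` comes from the all-ones vector. -/
theorem exists_pos_eigenvector {b : ZMod n} {ρ : ℝ} (hρ : 0 < ρ) :
    ∃ (x : ZMod n → ℝ) (μ : ℝ), perturbedCycleMatrix n b 1 ρ *ᵥ x = μ • x ∧ 4 < μ ∧
      ∀ i, x i ≠ 0 := by
  set K := perturbedCycleMatrix n b 1 ρ with hK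
  have hKs : K.IsSymm := perturbedCycleMatrix_isSymm b 1 ρ
  obtain ⟨x₀, θ₀, hx₀, hx₀0⟩ := exists_eigenvector_apply_ne_zero hKs (0 : ZMod n)
  obtain ⟨μ, ⟨x, hx, hx0⟩, hmax⟩ := Set.exists_max_image _ id (finite_eigenvalues K)
    ⟨θ₀, x₀, hx₀, fun h => hx₀0 (by simp [h])⟩
  simp only [id] at hmax
  set A := μ • (1 : Matrix (ZMod n) (ZMod n) ℝ) - K with hA
  have hAx : ∀ y, A *ᵥ y = μ • y - K *ᵥ y := fun y => by
    rw [hA, sub_mulVec, smul_mulVec, one_mulVec]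
  have hAH : A.IsHermitian := by
    rw [Matrix.IsHermitian, conjTranspose_eq_transpose_of_trivial, hA, transpose_sub, hKs.eq,
      transpose_smul, transpose_one]
  have hpsd : A.PosSemidef := by
    rw [hAH.posSemidef_iff_eigenvalues_nonneg]
    intro j
    have h1 := hAH.mulVec_eigenvectorBasis j
    rw [hAx, sub_eq_iff_eq_add] at h1
    have h2 : μ - hAH.eigenvalues j ≤ μ := by
      refine hmax _ ⟨(hAH.eigenvectorBasis j).ofLp, ?_, ?_⟩
      · rw [sub_smul, h1]; simp
      · intro h0
        have := hAH.eigenvectorBasis.orthonormal.ne_zero j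
        exact this (by ext i; simpa using congrFun h0 i)
    simpa using h2
  have hform : ∀ y, 0 ≤ y ⬝ᵥ (A *ᵥ y) := fun y => by
    simpa using hpsd.dotProduct_mulVec_nonneg y
  have hquad := dotProduct_perturbedCycleMatrix_mulVec b (one_pow 2) ρ
  have hμ : 4 < μ := by
    have h1 := hform fun _ => 1
    rw [hAx, dotProduct_sub, dotProduct_smul, hquad] at h1
    simp only [dotProduct, mul_one, Finset.sum_const, Finset.card_univ, ZMod.card, nsmul_eq_mul,
      smul_eq_mul] at h1
    have hn : (0 : ℝ) < n := by exact_mod_cast NeZero.pos n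
    by_contra! h2
    nlinarith
  -- The absolute value of a maximizer of the Rayleigh quotient is a maximizer, too.
  set y : ZMod n → ℝ := fun i => |x i| with hy
  have hy0 : A *ᵥ y = 0 := by
    have h1 : y ⬝ᵥ (A *ᵥ y) ≤ x ⬝ᵥ (A *ᵥ x) := by
      rw [hAx, hAx, dotProduct_sub, dotProduct_sub, dotProduct_smul, dotProduct_smul, hquad, hquad]
      have h2 : y ⬝ᵥ y = x ⬝ᵥ x := by simp [dotProduct, hy]
      have h3 : ∀ i j, (x i + 1 * x j) ^ 2 ≤ (y i + 1 * y j) ^ 2 := by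
        intro i j
        rw [one_mul, one_mul, sq_le_sq, abs_of_nonneg (a := y i + y j) (by positivity)]
        exact abs_add_le _ _
      have h4 := Finset.sum_le_sum fun i (_ : i ∈ Finset.univ) => h3 i (i + 1)
      have h5 := mul_le_mul_of_nonneg_left (h3 0 b) hρ.le
      rw [h2]
      linarith
    rw [hAx x, hx, sub_self, dotProduct_zero] at h1
    have h2 := hpsd.dotProduct_mulVec_zero_iff y
    simp only [star_trivial] at h2
    exact h2.1 (le_antisymm h1 (hform y))
  have hKy : K *ᵥ y = μ • y := by
    rw [hAx, sub_eq_zero] at hy0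
    exact hy0.symm
  refine ⟨y, μ, hKy, hμ, fun i hi => hx0 ?_⟩
  have hyn : ∀ i, 0 ≤ y i := fun i => abs_nonneg _
  have hstep : ∀ i, y i = 0 → y (i + 1) = 0 := by
    intro i hi
    have h1 := congrFun hKy i
    rw [hK, perturbedCycleMatrix_mulVec, Pi.smul_apply, hi, smul_zero] at h1
    have h2 : 0 ≤ ρ * ((if i = 0 then 1 else 0) + 1 * if i = b then 1 else 0) *
        (y 0 + 1 * y b) := by
      have := hyn 0
      have := hyn b
      split_ifs <;> positivity
    have := hyn (i - 1)
    have := hyn (i + 1)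
    linarith
  have hall : ∀ k : ℕ, y (i + k) = 0 := by
    intro k
    induction k with
    | zero => simpa using hi
    | succ k ih => rw [Nat.cast_succ, ← add_assoc]; exact hstep _ ih
  funext j
  have := hall (j - i).val
  rw [ZMod.natCast_zmod_val, add_sub_cancel] at this
  exact abs_eq_zero.1 this

end Perron

/-! ### Powers of nonnegative matrices -/

section Growth

variable {V : Type*} [Fintype V] [DecidableEq V] {N : Matrix V V ℝ} (hN : ∀ i j, 0 ≤ N i j)

include hN

theorem pow_mulVec_nonneg {z : V → ℝ} (hz : ∀ i, 0 ≤ z i) (k : ℕ) (i : V) :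
    0 ≤ (N ^ k *ᵥ z) i := by
  induction k generalizing i with
  | zero => simpa using hz i
  | succ k ih =>
    rw [pow_succ', ← mulVec_mulVec]
    exact Finset.sum_nonneg fun j _ => mul_nonneg (hN i j) (ih j)

theorem pow_succ_mulVec_pos {z : V → ℝ} (hz : ∀ i, 0 ≤ z i) {k : ℕ} {i j : V} (hij : 0 < N i j)
    (hj : 0 < (N ^ k *ᵥ z) j) : 0 < (N ^ (k + 1) *ᵥ z) i := by
  rw [pow_succ', ← mulVec_mulVec]
  exact Finset.sum_pos' (fun j _ => mul_nonneg (hN i j) (pow_mulVec_nonneg hN hz k j))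
    ⟨j, Finset.mem_univ j, mul_pos hij hj⟩

omit [DecidableEq V] in
theorem exists_pos_of_mulVec_ne_zero {z : V → ℝ} {i : V} (h : (N *ᵥ z) i ≠ 0) :
    ∃ j, 0 < N i j ∧ z j ≠ 0 := by
  obtain ⟨j, -, hj⟩ := Finset.exists_ne_zero_of_sum_ne_zero h
  exact ⟨j, lt_of_le_of_ne (hN i j) (left_ne_zero_of_mul hj).symm, right_ne_zero_of_mul hj⟩

theorem pow_mulVec_pos_of_le (hdiag : ∀ i, 0 < N i i) {z : V → ℝ} (hz : ∀ i, 0 ≤ z i) {k m : ℕ}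
    (hkm : k ≤ m) {i : V} (h : 0 < (N ^ k *ᵥ z) i) : 0 < (N ^ m *ᵥ z) i := by
  induction m, hkm using Nat.le_induction with
  | base => exact h
  | succ m _ ih => exact pow_succ_mulVec_pos hN hz (hdiag i) ih

/-- If `z ≥ 0` is annihilated by a monic polynomial of degree `d + 1`, then the support of `N ^ d z`
is closed under passing to neighbours: `N ^ (d + 1) z` is a combination of the lower powers, whose
supports are contained in that of `N ^ d z` since the diagonal of `N` is positive. -/
theorem pow_mulVec_pos_of_adjacent (hdiag : ∀ i, 0 < N i i) {z : V → ℝ} (hz : ∀ i, 0 ≤ z i)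
    {f : ℝ[X]} {d : ℕ} (hf : f.Monic) (hd : f.natDegree = d + 1) (h0 : aeval N f *ᵥ z = 0)
    {i j : V} (hij : 0 < N i j) (hj : 0 < (N ^ d *ᵥ z) j) : 0 < (N ^ d *ᵥ z) i := by
  have hpos := pow_succ_mulVec_pos hN hz hij hj
  by_contra hi
  have hzero : ∀ k ∈ Finset.range (d + 1), ((f.coeff k • N ^ k) *ᵥ z) i = 0 := by
    intro k hk
    rw [smul_mulVec, Pi.smul_apply]
    by_contra hne
    refine hi (pow_mulVec_pos_of_le hN hdiag hz (Nat.lt_succ_iff.1 (Finset.mem_range.1 hk))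
      (lt_of_le_of_ne (pow_mulVec_nonneg hN hz k i) fun h => hne ?_))
    rw [← h, smul_zero]
  have h1 := congrFun h0 i
  have hc : f.coeff (d + 1) = 1 := by rw [← hd]; exact hf
  rw [aeval_eq_sum_range, hd, Finset.sum_range_succ, add_mulVec, sum_mulVec, Pi.add_apply,
    Finset.sum_apply, Finset.sum_eq_zero hzero, hc, one_smul, zero_add, Pi.zero_apply] at h1
  exact hpos.ne' h1

/-- A vertex `w` at distance two from `u` has `(N² e_u)_w > 0`. In a quadratic relation for
`e_u - e_v` only a contribution of `v` can compensate it. -/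
theorem exists_two_step_of_quadratic {u v : V} {f : ℝ[X]} (hf : f.Monic) (hd : f.natDegree = 2)
    (h0 : aeval N f *ᵥ (Pi.single u 1 - Pi.single v 1) = 0) (hdiag : ∀ i, 0 < N i i) {w j : V}
    (hwu : ¬ 0 < N w u) (hwj : 0 < N w j) (hju : 0 < N j u) : ∃ k, 0 < N w k ∧ 0 < N k v := by
  by_contra! hcon
  have hne : ∀ {a c : V}, ¬ 0 < N a c → N a c = 0 := fun h => le_antisymm (not_lt.1 h) (hN _ _)
  have hwv : N w v = 0 := hne fun h => (hcon v h).not_gt (hdiag v)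
  have hwu1 : w ≠ u := by rintro rfl; exact hwu (hdiag w)
  have hwv1 : w ≠ v := by rintro rfl; exact (hdiag w).ne' hwv
  have hsq : (N ^ 2) w v = 0 := by
    rw [pow_two, mul_apply]
    refine Finset.sum_eq_zero fun k _ => ?_
    by_cases hk : 0 < N w k
    · rw [hne (hcon k hk).not_gt, mul_zero]
    · rw [hne hk, zero_mul]
  have hsq' : 0 < (N ^ 2) w u := by
    rw [pow_two, mul_apply]
    exact Finset.sum_pos' (fun k _ => mul_nonneg (hN _ _) (hN _ _))
      ⟨j, Finset.mem_univ j, mul_pos hwj hju⟩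
  have hc : f.coeff 2 = 1 := by rw [← hd]; exact hf
  have h1 := congrFun h0 w
  rw [aeval_eq_sum_range, hd] at h1
  simp [Finset.sum_range_succ, mulVec_sub, hc, hwv, hne hwu, hsq, hwu1,
    hwv1] at h1
  exact hsq'.ne' h1

end Growth

/-! ### Balls in the perturbed cycle -/

section Distances

variable {n : ℕ}

/-- The vertices `i` and `j` of the perturbed cycle are equal or adjacent. -/
def IsNear (b i j : ZMod n) : Prop :=
  i = j ∨ i = j + 1 ∨ i = j - 1 ∨ (i = 0 ∧ j = b) ∨ (i = b ∧ j = 0)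

/-- `N` is entrywise nonnegative, and positive exactly at equal or adjacent vertices of the
perturbed cycle. -/
def IsAdapted (b : ZMod n) (N : Matrix (ZMod n) (ZMod n) ℝ) : Prop :=
  ∀ i j, 0 ≤ N i j ∧ (0 < N i j ↔ IsNear b i j)

/-- The vertices `c - k, …, c + k` of the cycle. -/
noncomputable def cyclicInterval (n : ℕ) (c : ZMod n) (k : ℕ) : Finset (ZMod n) :=
  (Finset.Icc (-k : ℤ) k).image fun m : ℤ => c + (m : ZMod n)

theorem card_cyclicInterval_le (c : ZMod n) (k : ℕ) : (cyclicInterval n c k).card ≤ 2 * k + 1 := by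
  refine Finset.card_image_le.trans ?_
  rw [Int.card_Icc]; omega

theorem self_mem_cyclicInterval (c : ZMod n) (k : ℕ) : c ∈ cyclicInterval n c k :=
  Finset.mem_image.2 ⟨0, by simp, by simp⟩

theorem IsNear.mem_cyclicInterval {b c i j : ZMod n} {k : ℕ} (h : IsNear b i j)
    (hj : j ∈ cyclicInterval n c k) :
    i ∈ cyclicInterval n c (k + 1) ∨ (i = 0 ∧ j = b) ∨ (i = b ∧ j = 0) := by
  obtain ⟨m, hm, rfl⟩ := Finset.mem_image.1 hj
  rw [Finset.mem_Icc] at hm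
  rcases h with h | h | h | h | h
  · exact Or.inl (Finset.mem_image.2 ⟨m, Finset.mem_Icc.2 (by push_cast; omega), h.symm⟩)
  · exact Or.inl (Finset.mem_image.2 ⟨m + 1, Finset.mem_Icc.2 (by push_cast; omega), by
      rw [h]; push_cast; ring⟩)
  · exact Or.inl (Finset.mem_image.2 ⟨m - 1, Finset.mem_Icc.2 (by push_cast; omega), by
      rw [h]; push_cast; ring⟩)
  · exact Or.inr (Or.inl h)
  · exact Or.inr (Or.inr h)

/-- All vertices equal or adjacent to a vertex of `A` belong to `B`. -/
def StepsInto (b : ZMod n) (A B : Finset (ZMod n)) : Prop :=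
  ∀ j ∈ A, ∀ i, IsNear b i j → i ∈ B

theorem StepsInto.union {b : ZMod n} {A A' B : Finset (ZMod n)} (h : StepsInto b A B)
    (h' : StepsInto b A' B) : StepsInto b (A ∪ A') B := fun j hj i hi =>
  (Finset.mem_union.1 hj).elim (fun h1 => h j h1 i hi) fun h1 => h' j h1 i hi

/-- The chord can be left out where its ends are not in the interval. -/
theorem stepsInto_of_notMem {b c : ZMod n} {k : ℕ} {B : Finset (ZMod n)}
    (hB : cyclicInterval n c (k + 1) ⊆ B)
    (h0 : b ∈ cyclicInterval n c k → 0 ∈ B) (hb : 0 ∈ cyclicInterval n c k → b ∈ B) :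
    StepsInto b (cyclicInterval n c k) B := by
  intro j hj i hi
  rcases hi.mem_cyclicInterval hj with h | ⟨rfl, rfl⟩ | ⟨rfl, rfl⟩
  · exact hB h
  · exact h0 hj
  · exact hb hj

theorem cyclicInterval_zero (c : ZMod n) : cyclicInterval n c 0 = {c} := by
  simp [cyclicInterval]

variable [NeZero n] {b : ZMod n} {N : Matrix (ZMod n) (ZMod n) ℝ}

theorem IsAdapted.mem_of_stepsInto (hN : IsAdapted b N) {z : ZMod n → ℝ} {A B : Finset (ZMod n)}
    {k : ℕ} (hA : ∀ i, (N ^ k *ᵥ z) i ≠ 0 → i ∈ A) (hAB : StepsInto b A B) (i : ZMod n)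
    (hi : (N ^ (k + 1) *ᵥ z) i ≠ 0) : i ∈ B := by
  rw [pow_succ', ← mulVec_mulVec] at hi
  obtain ⟨j, hij, hj⟩ := exists_pos_of_mulVec_ne_zero (fun i j => (hN i j).1) hi
  exact hAB j (hA j hj) i ((hN i j).2.1 hij)

/-- Since `N ^ d z` is positive everywhere, any set `F` that contains its support has at least `n`
elements. -/
theorem IsAdapted.le_card (hN : IsAdapted b N) {z : ZMod n → ℝ} (hz : ∀ i, 0 ≤ z i) {u : ZMod n}
    (hu : 0 < z u) {f : ℝ[X]} {d : ℕ} (hf : f.Monic) (hd : f.natDegree = d + 1)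
    (h0 : aeval N f *ᵥ z = 0) {F : Finset (ZMod n)} (hF : ∀ i, (N ^ d *ᵥ z) i ≠ 0 → i ∈ F) :
    n ≤ F.card := by
  have hNn : ∀ i j, 0 ≤ N i j := fun i j => (hN i j).1
  have hdiag : ∀ i, 0 < N i i := fun i => (hN i i).2.2 (Or.inl rfl)
  have hpos : ∀ k : ℕ, 0 < (N ^ d *ᵥ z) (u + k) := by
    intro k
    induction k with
    | zero =>
      refine pow_mulVec_pos_of_le hNn hdiag hz (Nat.zero_le d) ?_
      simpa using hu
    | succ k ih =>
      refine pow_mulVec_pos_of_adjacent hNn hdiag hz hf hd h0 ?_ ih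
      exact (hN _ _).2.2 (Or.inr (Or.inl (by push_cast; ring)))
  have huniv : F = Finset.univ := by
    refine Finset.eq_univ_of_forall fun i => hF i ?_
    have := hpos (i - u).val
    rw [ZMod.natCast_zmod_val, add_sub_cancel] at this
    exact this.ne'
  rw [huniv, Finset.card_univ, ZMod.card]

end Distances

/-! ### Bounds on the order from annihilated nonnegative vectors -/

section Counting

variable {n : ℕ} {b : ZMod n}

theorem stepsInto_of_ends_mem {c : ZMod n} {k : ℕ} {B : Finset (ZMod n)}
    (hB : cyclicInterval n c (k + 1) ⊆ B) (h0 : 0 ∈ B) (hb : b ∈ B) :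
    StepsInto b (cyclicInterval n c k) B :=
  stepsInto_of_notMem hB (fun _ => h0) fun _ => hb

theorem stepsInto_union_ends (c : ZMod n) (k l m : ℕ) :
    StepsInto b (cyclicInterval n c k ∪ (cyclicInterval n 0 l ∪ cyclicInterval n b m))
      (cyclicInterval n c (k + 1) ∪ (cyclicInterval n 0 (l + 1) ∪ cyclicInterval n b (m + 1))) := by
  have h0 : (0 : ZMod n) ∈ cyclicInterval n c (k + 1) ∪
      (cyclicInterval n 0 (l + 1) ∪ cyclicInterval n b (m + 1)) := by
    simp [self_mem_cyclicInterval]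
  have hb : b ∈ cyclicInterval n c (k + 1) ∪
      (cyclicInterval n 0 (l + 1) ∪ cyclicInterval n b (m + 1)) := by
    simp [self_mem_cyclicInterval]
  refine (stepsInto_of_ends_mem ?_ h0 hb).union ((stepsInto_of_ends_mem ?_ h0 hb).union
    (stepsInto_of_ends_mem ?_ h0 hb))
  · exact Finset.subset_union_left
  · exact Finset.subset_union_left.trans Finset.subset_union_right
  · exact Finset.subset_union_right.trans Finset.subset_union_right

theorem card_union_ends_le (c : ZMod n) (k l m : ℕ) :
    (cyclicInterval n c k ∪ (cyclicInterval n 0 l ∪ cyclicInterval n b m)).card ≤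
      2 * (k + l + m) + 3 := by
  have h1 := Finset.card_union_le (cyclicInterval n c k)
    (cyclicInterval n 0 l ∪ cyclicInterval n b m)
  have h2 := Finset.card_union_le (cyclicInterval n 0 l) (cyclicInterval n b m)
  have h3 := card_cyclicInterval_le c k
  have h4 := card_cyclicInterval_le (0 : ZMod n) l
  have h5 := card_cyclicInterval_le b m
  omega

theorem card_ends_le (l m : ℕ) :
    (cyclicInterval n 0 l ∪ cyclicInterval n b m).card ≤ 2 * (l + m) + 2 := by
  have h2 := Finset.card_union_le (cyclicInterval n 0 l) (cyclicInterval n b m)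
  have h4 := card_cyclicInterval_le (0 : ZMod n) l
  have h5 := card_cyclicInterval_le b m
  omega

variable {u v : ZMod n}

theorem stepsInto_singleton_of_ne (h0 : u ≠ 0) (hb : u ≠ b) {B : Finset (ZMod n)}
    (hB : cyclicInterval n u 1 ⊆ B) : StepsInto b (cyclicInterval n u 0) B := by
  refine stepsInto_of_notMem hB (fun h => ?_) fun h => ?_
  · simp only [cyclicInterval_zero, Finset.mem_singleton] at h
    exact absurd h.symm hb
  · simp only [cyclicInterval_zero, Finset.mem_singleton] at h
    exact absurd h.symm h0

theorem single_one_nonneg (u i : ZMod n) : 0 ≤ (Pi.single u 1 : ZMod n → ℝ) i := by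
  rw [Pi.single_apply]; split_ifs <;> norm_num

variable [NeZero n] {N : Matrix (ZMod n) (ZMod n) ℝ}

theorem IsAdapted.mem_union_ends_succ (hN : IsAdapted b N) {z : ZMod n → ℝ} {c : ZMod n}
    {d k l m : ℕ} (h : ∀ i, (N ^ d *ᵥ z) i ≠ 0 →
      i ∈ cyclicInterval n c k ∪ (cyclicInterval n 0 l ∪ cyclicInterval n b m)) :
    ∀ i, (N ^ (d + 1) *ᵥ z) i ≠ 0 →
      i ∈ cyclicInterval n c (k + 1) ∪
        (cyclicInterval n 0 (l + 1) ∪ cyclicInterval n b (m + 1)) :=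
  hN.mem_of_stepsInto h (stepsInto_union_ends c k l m)

theorem IsAdapted.mem_ends_succ (hN : IsAdapted b N) {z : ZMod n → ℝ}
    {d l m : ℕ} (h : ∀ i, (N ^ d *ᵥ z) i ≠ 0 →
      i ∈ cyclicInterval n 0 l ∪ cyclicInterval n b m) :
    ∀ i, (N ^ (d + 1) *ᵥ z) i ≠ 0 →
      i ∈ cyclicInterval n 0 (l + 1) ∪ cyclicInterval n b (m + 1) := by
  refine hN.mem_of_stepsInto h ((stepsInto_of_ends_mem Finset.subset_union_left ?_ ?_).union
    (stepsInto_of_ends_mem Finset.subset_union_right ?_ ?_)) <;> simp [self_mem_cyclicInterval]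

theorem mem_cyclicInterval_zero_of_single (i : ZMod n)
    (hi : (N ^ 0 *ᵥ Pi.single u 1) i ≠ 0) : i ∈ cyclicInterval n u 0 := by
  by_contra h
  simp only [cyclicInterval_zero, Finset.mem_singleton] at h
  simp [h] at hi

theorem mem_cyclicInterval_zero_of_add (i : ZMod n)
    (hi : (N ^ 0 *ᵥ (Pi.single u 1 + Pi.single v 1 : ZMod n → ℝ)) i ≠ 0) :
    i ∈ cyclicInterval n u 0 ∪ cyclicInterval n v 0 := by
  by_contra h
  simp only [cyclicInterval_zero, Finset.mem_union, Finset.mem_singleton, not_or] at h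
  simp [h.1, h.2] at hi

theorem IsAdapted.mem_of_ne (hN : IsAdapted b N) (h0 : u ≠ 0) (hb : u ≠ b) (i : ZMod n)
    (hi : (N ^ 2 *ᵥ Pi.single u 1) i ≠ 0) :
    i ∈ cyclicInterval n u 2 ∪ (cyclicInterval n 0 0 ∪ cyclicInterval n b 0) := by
  refine hN.mem_of_stepsInto (A := cyclicInterval n u 1)
    (hN.mem_of_stepsInto mem_cyclicInterval_zero_of_single
      (stepsInto_singleton_of_ne h0 hb subset_rfl)) ?_ i hi
  refine stepsInto_of_ends_mem Finset.subset_union_left ?_ ?_ <;> simp [self_mem_cyclicInterval]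

theorem IsAdapted.mem_zero (hN : IsAdapted b N) (i : ZMod n)
    (hi : (N ^ 1 *ᵥ Pi.single 0 1) i ≠ 0) :
    i ∈ cyclicInterval n 0 1 ∪ cyclicInterval n b 0 := by
  refine hN.mem_of_stepsInto mem_cyclicInterval_zero_of_single
    (stepsInto_of_ends_mem Finset.subset_union_left ?_ ?_) i hi <;> simp [self_mem_cyclicInterval]

theorem IsAdapted.mem_end (hN : IsAdapted b N) (i : ZMod n)
    (hi : (N ^ 1 *ᵥ Pi.single b 1) i ≠ 0) :
    i ∈ cyclicInterval n 0 0 ∪ cyclicInterval n b 1 := by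
  refine hN.mem_of_stepsInto mem_cyclicInterval_zero_of_single
    (stepsInto_of_ends_mem Finset.subset_union_right ?_ ?_) i hi <;> simp [self_mem_cyclicInterval]

/-- Balls of radius two in the perturbed cycle have at most eight vertices. -/
theorem IsAdapted.le_eight_of_cubic (hN : IsAdapted b N) {f : ℝ[X]} (hf : f.Monic)
    (hd : f.natDegree = 3) (h : aeval N f *ᵥ Pi.single u 1 = 0) : n ≤ 8 := by
  have key := fun F => hN.le_card (single_one_nonneg u) (u := u) (by simp) hf hd h (F := F)
  by_cases h0 : u = 0
  · subst h0
    exact (key _ (hN.mem_ends_succ hN.mem_zero)).trans (card_ends_le _ _)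
  by_cases hb : u = b
  · subst hb
    exact (key _ (hN.mem_ends_succ hN.mem_end)).trans (card_ends_le _ _)
  exact (key _ (hN.mem_of_ne h0 hb)).trans ((card_union_ends_le _ _ _ _).trans (by norm_num))

/-- Balls of radius three in the perturbed cycle have at most thirteen vertices. -/
theorem IsAdapted.le_thirteen_of_quartic (hN : IsAdapted b N) {f : ℝ[X]} (hf : f.Monic)
    (hd : f.natDegree = 4) (h : aeval N f *ᵥ Pi.single u 1 = 0) : n ≤ 13 := by
  have key := fun F => hN.le_card (single_one_nonneg u) (u := u) (by simp) hf hd h (F := F)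
  by_cases h0 : u = 0
  · subst h0
    exact (key _ (hN.mem_ends_succ (hN.mem_ends_succ hN.mem_zero))).trans
      ((card_ends_le _ _).trans (by norm_num))
  by_cases hb : u = b
  · subst hb
    exact (key _ (hN.mem_ends_succ (hN.mem_ends_succ hN.mem_end))).trans
      ((card_ends_le _ _).trans (by norm_num))
  exact (key _ (hN.mem_union_ends_succ (hN.mem_of_ne h0 hb))).trans (card_union_ends_le _ _ _ _)

/-- The union of the two balls of radius one consists of two intervals and the ends of the chord. -/
theorem IsAdapted.le_eight_of_quadratic_add (hN : IsAdapted b N) {f : ℝ[X]} (hf : f.Monic)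
    (hd : f.natDegree = 2) (h : aeval N f *ᵥ (Pi.single u 1 + Pi.single v 1) = 0) : n ≤ 8 := by
  have hz : ∀ i, 0 ≤ (Pi.single u 1 + Pi.single v 1 : ZMod n → ℝ) i := fun i =>
    add_nonneg (single_one_nonneg u i) (single_one_nonneg v i)
  have hu : 0 < (Pi.single u 1 + Pi.single v 1 : ZMod n → ℝ) u := by
    have := single_one_nonneg v u
    rw [Pi.add_apply, Pi.single_eq_same]; linarith
  refine (hN.le_card hz hu hf hd h (F := cyclicInterval n u 1 ∪ (cyclicInterval n v 1 ∪
    (cyclicInterval n 0 0 ∪ cyclicInterval n b 0)))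
    (hN.mem_of_stepsInto mem_cyclicInterval_zero_of_add ((stepsInto_of_ends_mem
      Finset.subset_union_left ?_ ?_).union (stepsInto_of_ends_mem
      (Finset.subset_union_left.trans Finset.subset_union_right) ?_ ?_)))).trans ?_
  any_goals simp [self_mem_cyclicInterval]
  have h1 := Finset.card_union_le (cyclicInterval n u 1) (cyclicInterval n v 1 ∪
    (cyclicInterval n 0 0 ∪ cyclicInterval n b 0))
  have h2 := card_union_ends_le (b := b) v 1 0 0
  have h3 := card_cyclicInterval_le u 1
  omega

/-- The union of two balls of radius two has at most thirteen vertices. If one centre is an end of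
the chord, its ball contains the vertices reached from the other centre through the chord. -/
theorem IsAdapted.le_thirteen_of_cubic_add (hN : IsAdapted b N) {f : ℝ[X]} (hf : f.Monic)
    (hd : f.natDegree = 3) (h : aeval N f *ᵥ (Pi.single u 1 + Pi.single v 1) = 0) : n ≤ 13 := by
  have hz : ∀ u v i, 0 ≤ (Pi.single u 1 + Pi.single v 1 : ZMod n → ℝ) i := fun u v i =>
    add_nonneg (single_one_nonneg u i) (single_one_nonneg v i)
  have hu : ∀ u v, 0 < (Pi.single u 1 + Pi.single v 1 : ZMod n → ℝ) u := fun u v => by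
    have := single_one_nonneg v u
    rw [Pi.add_apply, Pi.single_eq_same]; linarith
  have hzero : ∀ v, aeval N f *ᵥ (Pi.single 0 1 + Pi.single v 1) = 0 → n ≤ 13 := fun v h => by
    refine (hN.le_card (hz _ _) (hu _ _) hf hd h (hN.mem_union_ends_succ (c := v) (k := 1) (l := 1)
      (m := 0) (hN.mem_of_stepsInto mem_cyclicInterval_zero_of_add ((stepsInto_of_ends_mem
      (Finset.subset_union_left.trans Finset.subset_union_right) ?_ ?_).union
        (stepsInto_of_ends_mem Finset.subset_union_left ?_ ?_))))).trans (card_union_ends_le _ _ _ _)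
    all_goals simp [self_mem_cyclicInterval]
  have hend : ∀ v, aeval N f *ᵥ (Pi.single b 1 + Pi.single v 1) = 0 → n ≤ 13 := fun v h => by
    refine (hN.le_card (hz _ _) (hu _ _) hf hd h (hN.mem_union_ends_succ (c := v) (k := 1) (l := 0)
      (m := 1) (hN.mem_of_stepsInto mem_cyclicInterval_zero_of_add ((stepsInto_of_ends_mem
      (Finset.subset_union_right.trans Finset.subset_union_right) ?_ ?_).union
        (stepsInto_of_ends_mem Finset.subset_union_left ?_ ?_))))).trans (card_union_ends_le _ _ _ _)
    all_goals simp [self_mem_cyclicInterval]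
  by_cases hu0 : u = 0
  · exact hzero v (hu0 ▸ h)
  by_cases hub : u = b
  · exact hend v (hub ▸ h)
  by_cases hv0 : v = 0
  · exact hzero u (by rw [add_comm]; exact hv0 ▸ h)
  by_cases hvb : v = b
  · exact hend u (by rw [add_comm]; exact hvb ▸ h)
  refine (hN.le_card (hz _ _) (hu _ _) hf hd h (F := cyclicInterval n u 2 ∪ (cyclicInterval n v 2 ∪
    (cyclicInterval n 0 0 ∪ cyclicInterval n b 0)))
    (hN.mem_of_stepsInto (A := cyclicInterval n u 1 ∪ cyclicInterval n v 1)
    (hN.mem_of_stepsInto mem_cyclicInterval_zero_of_add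
      ((stepsInto_singleton_of_ne hu0 hub Finset.subset_union_left).union
        (stepsInto_singleton_of_ne hv0 hvb Finset.subset_union_right)))
      ((stepsInto_of_ends_mem
      Finset.subset_union_left ?_ ?_).union (stepsInto_of_ends_mem
      (Finset.subset_union_left.trans Finset.subset_union_right) ?_ ?_)))).trans ?_
  any_goals simp [self_mem_cyclicInterval]
  have h1 := Finset.card_union_le (cyclicInterval n u 2) (cyclicInterval n v 2 ∪
    (cyclicInterval n 0 0 ∪ cyclicInterval n b 0))
  have h2 := card_union_ends_le (b := b) v 2 0 0
  have h3 := card_cyclicInterval_le u 2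
  omega

end Counting

/-! ### Annihilated differences of vertex vectors -/

section Difference

variable {n : ℕ} {b : ZMod n} {u v : ZMod n}

theorem intCast_zmod_eq_zero {k : ℤ} (h : (k : ZMod n) = 0) (h1 : -n < k) (h2 : k < n) : k = 0 := by
  rw [ZMod.intCast_zmod_eq_zero_iff_dvd] at h
  exact Int.eq_zero_of_abs_lt_dvd h (abs_lt.2 ⟨h1, h2⟩)

theorem add_two_ne (hn : 9 ≤ n) {s : ℤ} (hs : s = 2 ∨ s = -2) :
    u + s ≠ u ∧ u + s ≠ u + 1 ∧ u + s ≠ u - 1 := by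
  refine ⟨fun h => ?_, fun h => ?_, fun h => ?_⟩
  · have h1 : ((s : ℤ) : ZMod n) = 0 := by linear_combination h
    have := intCast_zmod_eq_zero h1 (by omega) (by omega)
    omega
  · have h1 : ((s - 1 : ℤ) : ZMod n) = 0 := by push_cast; linear_combination h
    have := intCast_zmod_eq_zero h1 (by omega) (by omega)
    omega
  · have h1 : ((s + 1 : ℤ) : ZMod n) = 0 := by push_cast; linear_combination h
    have := intCast_zmod_eq_zero h1 (by omega) (by omega)
    omega

theorem exists_isNear_add_two {s : ℤ} (hs : s = 2 ∨ s = -2) :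
    ∃ j, IsNear b (u + s) j ∧ IsNear b j u := by
  rcases hs with rfl | rfl
  · exact ⟨u + 1, Or.inr (Or.inl (by push_cast; ring)), Or.inr (Or.inl rfl)⟩
  · exact ⟨u - 1, Or.inr (Or.inr (Or.inl (by push_cast; ring))), Or.inr (Or.inr (Or.inl rfl))⟩

/-- The vertices `u ± 2` cannot both be close to `v` along the cycle, so one of them is reached from
`v` through the chord, which then joins `u ± 2` to `v ± 1`. By symmetry it joins `v ± 2` to
`u ± 1`, and these two descriptions of the chord are incompatible. -/
theorem false_of_difference_of_ne (hn : 9 ≤ n) (huv : u ≠ v) (hu0 : u ≠ 0) (hub : u ≠ b)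
    (hv0 : v ≠ 0) (hvb : v ≠ b)
    (H : ∀ w, ¬ IsNear b w u → (∃ j, IsNear b w j ∧ IsNear b j u) →
      ∃ j, IsNear b w j ∧ IsNear b j v)
    (H' : ∀ w, ¬ IsNear b w v → (∃ j, IsNear b w j ∧ IsNear b j v) →
      ∃ j, IsNear b w j ∧ IsNear b j u) : False := by
  have key : ∀ u v : ZMod n, u ≠ 0 → u ≠ b → v ≠ 0 → v ≠ b →
      (∀ w, ¬ IsNear b w u → (∃ j, IsNear b w j ∧ IsNear b j u) →
        ∃ j, IsNear b w j ∧ IsNear b j v) → ∀ s : ℤ, s = 2 ∨ s = -2 →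
      (∃ m : ℤ, -2 ≤ m ∧ m ≤ 2 ∧ u + s = v + m) ∨ ∃ t : ℤ, (t = 1 ∨ t = -1) ∧
        ((u + s = 0 ∧ v + t = b) ∨ (u + s = b ∧ v + t = 0)) := by
    intro u v hu0 hub hv0 hvb H s hs
    obtain ⟨h1, h2, h3⟩ := add_two_ne (u := u) hn hs
    obtain ⟨j, hj, hjv⟩ := H (u + s) (by
      rintro (h | h | h | h | h)
      exacts [h1 h, h2 h, h3 h, hub h.2, hu0 h.2]) (exists_isNear_add_two hs)
    obtain ⟨t, ht, rfl⟩ : ∃ t : ℤ, (t = 0 ∨ t = 1 ∨ t = -1) ∧ j = v + t := by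
      rcases hjv with h | h | h | h | h
      · exact ⟨0, by simp, by simp [h]⟩
      · exact ⟨1, by simp, by simp [h]⟩
      · exact ⟨-1, by simp, by rw [h]; push_cast; ring⟩
      · exact absurd h.2 hvb
      · exact absurd h.2 hv0
    have ht' : v + t = 0 ∨ v + t = b → t = 1 ∨ t = -1 := by
      intro h
      rcases ht with rfl | ht
      · rw [Int.cast_zero, add_zero] at h
        exact absurd h (not_or.2 ⟨hv0, hvb⟩)
      · exact ht
    rcases hj with h | h | h | h | h
    · exact Or.inl ⟨t, by omega, by omega, h⟩
    · exact Or.inl ⟨t + 1, by omega, by omega, by rw [h]; push_cast; ring⟩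
    · exact Or.inl ⟨t - 1, by omega, by omega, by rw [h]; push_cast; ring⟩
    · exact Or.inr ⟨t, ht' (Or.inr h.2), Or.inl h⟩
    · exact Or.inr ⟨t, ht' (Or.inl h.2), Or.inr h⟩
  have chord : ∀ u v : ZMod n, u ≠ v → u ≠ 0 → u ≠ b → v ≠ 0 → v ≠ b →
      (∀ w, ¬ IsNear b w u → (∃ j, IsNear b w j ∧ IsNear b j u) →
        ∃ j, IsNear b w j ∧ IsNear b j v) → ∃ s t : ℤ, (s = 2 ∨ s = -2) ∧ (t = 1 ∨ t = -1) ∧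
        ((u + s = 0 ∧ v + t = b) ∨ (u + s = b ∧ v + t = 0)) := by
    intro u v huv hu0 hub hv0 hvb H
    rcases key u v hu0 hub hv0 hvb H 2 (Or.inl rfl) with ⟨m, hm1, hm2, hm⟩ | ⟨t, ht, h⟩
    · rcases key u v hu0 hub hv0 hvb H (-2) (Or.inr rfl) with ⟨m', hm1', hm2', hm'⟩ | ⟨t, ht, h⟩
      · exfalso
        have h1 : ((4 - m + m' : ℤ) : ZMod n) = 0 := by
          push_cast at hm hm' ⊢; linear_combination hm - hm'
        have h2 := intCast_zmod_eq_zero h1 (by omega) (by omega)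
        obtain rfl : m = 2 := by omega
        exact huv (add_right_cancel hm)
      · exact ⟨-2, t, Or.inr rfl, ht, h⟩
    · exact ⟨2, t, Or.inl rfl, ht, h⟩
  obtain ⟨s, t, hs, ht, h1⟩ := chord u v huv hu0 hub hv0 hvb H
  obtain ⟨s', t', hs', ht', h2⟩ := chord v u huv.symm hv0 hvb hu0 hub H'
  have parallel : ∀ c d : ZMod n, u + s = c → v + t = d → v + s' = c → u + t' = d → False := by
    intro c d h1 h2 h3 h4
    have h5 : ((s' - s - t + t' : ℤ) : ZMod n) = 0 := by
      push_cast; linear_combination h3 - h1 + h4 - h2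
    have h6 := intCast_zmod_eq_zero h5 (by omega) (by omega)
    obtain rfl : s = s' := by omega
    exact huv (add_right_cancel (h1.trans h3.symm))
  have crossed : ∀ c : ZMod n, u + s = c → u + t' = c → False := by
    intro c h1 h2
    have h5 : ((s - t' : ℤ) : ZMod n) = 0 := by push_cast; linear_combination h1 - h2
    have h6 := intCast_zmod_eq_zero h5 (by omega) (by omega)
    omega
  rcases h1 with ⟨h1, h1'⟩ | ⟨h1, h1'⟩ <;> rcases h2 with ⟨h2, h2'⟩ | ⟨h2, h2'⟩
  · exact parallel _ _ h1 h1' h2 h2'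
  · exact crossed _ h1 h2'
  · exact crossed _ h1 h2'
  · exact parallel _ _ h1 h1' h2 h2'

/-- The vertices `2` and `-2` would both be within two cycle steps of `b`, which leaves only `b = 0`. -/
theorem false_of_difference_ends (hn : 9 ≤ n) (hb : b ≠ 0)
    (H : ∀ w, ¬ IsNear b w 0 → (∃ j, IsNear b w j ∧ IsNear b j 0) →
      ∃ j, IsNear b w j ∧ IsNear b j b) : False := by
  have key : ∀ s : ℤ, s = 2 ∨ s = -2 → ∃ m : ℤ, -2 ≤ m ∧ m ≤ 2 ∧ (s : ZMod n) = b + m := by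
    intro s hs
    obtain ⟨h1, h2, h3⟩ := add_two_ne (u := (0 : ZMod n)) hn hs
    rw [zero_add] at h1 h2 h3
    by_cases hsb : (s : ZMod n) = b
    · exact ⟨0, by omega, by omega, by simp [hsb]⟩
    obtain ⟨j, hj, hjb⟩ := H s (by
      rintro (h | h | h | h | h)
      exacts [h1 h, h2 h, h3 h, h1 h.1, hsb h.1]) (by
      have := exists_isNear_add_two (b := b) (u := 0) hs
      rwa [zero_add] at this)
    rcases hj with h | h | h | h | h
    · rcases hjb with h' | h' | h' | h' | h'
      · exact absurd (h.trans h') hsb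
      · exact ⟨1, by omega, by omega, by rw [h, h']; simp⟩
      · exact ⟨-1, by omega, by omega, by rw [h, h']; push_cast; ring⟩
      · exact absurd (h.trans h'.1) h1
      · exact absurd h'.2 hb
    · rcases hjb with h' | h' | h' | h' | h'
      · exact ⟨1, by omega, by omega, by rw [h, h']; simp⟩
      · exact ⟨2, by omega, by omega, by rw [h, h']; push_cast; ring⟩
      · exact ⟨0, by omega, by omega, by rw [h, h']; push_cast; ring⟩
      · exact absurd (by rw [h, h'.1]) h2
      · exact absurd h'.2 hb
    · rcases hjb with h' | h' | h' | h' | h'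
      · exact ⟨-1, by omega, by omega, by rw [h, h']; push_cast; ring⟩
      · exact ⟨0, by omega, by omega, by rw [h, h']; push_cast; ring⟩
      · exact ⟨-2, by omega, by omega, by rw [h, h']; push_cast; ring⟩
      · exact absurd (by rw [h, h'.1]) h3
      · exact absurd h'.2 hb
    · exact absurd h.1 h1
    · exact absurd h.1 hsb
  obtain ⟨m, hm1, hm2, hm⟩ := key 2 (Or.inl rfl)
  obtain ⟨m', hm1', hm2', hm'⟩ := key (-2) (Or.inr rfl)
  have h1 : ((4 - m + m' : ℤ) : ZMod n) = 0 := by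
    push_cast at hm hm' ⊢; linear_combination hm - hm'
  have h2 := intCast_zmod_eq_zero h1 (by omega) (by omega)
  obtain rfl : m = 2 := by omega
  refine hb ?_
  linear_combination -hm

variable [NeZero n] {N : Matrix (ZMod n) (ZMod n) ℝ}

theorem IsAdapted.le_eight_of_quadratic_sub (hN : IsAdapted b N) (hb : b ≠ 0) (huv : u ≠ v)
    (hends : u = 0 ∨ u = b ↔ v = 0 ∨ v = b) {f : ℝ[X]} (hf : f.Monic) (hd : f.natDegree = 2)
    (h : aeval N f *ᵥ (Pi.single u 1 - Pi.single v 1) = 0) : n ≤ 8 := by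
  by_contra! hn
  have H : ∀ u v : ZMod n, aeval N f *ᵥ (Pi.single u 1 - Pi.single v 1) = 0 →
      ∀ w, ¬ IsNear b w u → (∃ j, IsNear b w j ∧ IsNear b j u) →
      ∃ j, IsNear b w j ∧ IsNear b j v := by
    intro u v h w hw ⟨j, hwj, hju⟩
    obtain ⟨k, hk, hk'⟩ := exists_two_step_of_quadratic (fun i j => (hN i j).1) hf hd h
      (fun i => (hN i i).2.2 (Or.inl rfl)) (w := w) (j := j) (fun h => hw ((hN _ _).2.1 h))
      ((hN _ _).2.2 hwj) ((hN _ _).2.2 hju)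
    exact ⟨k, (hN _ _).2.1 hk, (hN _ _).2.1 hk'⟩
  have h' : aeval N f *ᵥ (Pi.single v 1 - Pi.single u 1) = 0 := by
    rw [← neg_sub, mulVec_neg, h, neg_zero]
  by_cases hu : u = 0 ∨ u = b
  · rcases hu with rfl | rfl <;> rcases hends.1 (by simp) with rfl | rfl
    · exact huv rfl
    · exact false_of_difference_ends hn hb (H _ _ h)
    · exact false_of_difference_ends hn hb (H _ _ h')
    · exact huv rfl
  · have hv : ¬ (v = 0 ∨ v = b) := fun hv => hu (hends.2 hv)
    push Not at hu hv
    exact false_of_difference_of_ne hn huv hu.1 hu.2 hv.1 hv.2 (H _ _ h) (H _ _ h')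

end Difference

/-! ### Absence of perfect state transfer -/

section NoTransfer

variable {n : ℕ} {b : ZMod n} {ρ : ℝ}

theorem isAdapted_signless (hρ : 0 < ρ) : IsAdapted b (perturbedCycleMatrix n b 1 ρ) := by
  intro i j
  have h1 : i = j - 1 ↔ j = i + 1 := ⟨fun h => by rw [h]; ring, fun h => by rw [h]; ring⟩
  simp only [perturbedCycleMatrix, of_apply, IsNear, h1]
  by_cases hij : i = j
  · simp only [hij, true_or, iff_true, if_true]
    constructor <;> split_ifs <;> positivity
  · simp only [hij, false_or, if_false]
    by_cases h2 : i = j + 1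
    · simp only [h2, true_or, iff_true, if_true]
      constructor <;> split_ifs <;> positivity
    by_cases h3 : j = i + 1
    · simp only [h3, true_or, or_true, iff_true, if_true]
      constructor <;> split_ifs <;> positivity
    simp only [h2, h3, false_or, if_false]
    by_cases h4 : i = 0 <;> by_cases h5 : j = 0 <;> by_cases h6 : i = b <;> by_cases h7 : j = b <;>
      simp_all [le_of_lt]

theorem isAdapted_laplacian (hρ : 0 < ρ) :
    IsAdapted b ((3 + ρ) • (1 : Matrix (ZMod n) (ZMod n) ℝ) - perturbedCycleMatrix n b (-1) ρ) := by
  intro i j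
  have h1 : i = j - 1 ↔ j = i + 1 := ⟨fun h => by rw [h]; ring, fun h => by rw [h]; ring⟩
  simp only [perturbedCycleMatrix, Matrix.sub_apply, Matrix.smul_apply, one_apply, smul_eq_mul,
    of_apply, IsNear, h1]
  by_cases hij : i = j
  · simp only [hij, true_or, iff_true, if_true]
    constructor <;> split_ifs <;> nlinarith
  · simp only [hij, false_or, if_false]
    have hchord : ((if i = 0 then (1 : ℝ) else 0) + -1 * if i = b then 1 else 0) *
        ((if j = 0 then 1 else 0) + -1 * if j = b then 1 else 0) =
        -if (i = 0 ∧ j = b) ∨ (i = b ∧ j = 0) then 1 else 0 := by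
      by_cases h4 : i = 0 <;> by_cases h5 : j = 0 <;> by_cases h6 : i = b <;>
        by_cases h7 : j = b <;> simp_all
    rw [hchord]
    by_cases h2 : i = j + 1
    · simp only [h2, true_or, iff_true, if_true]
      constructor <;> split_ifs <;> linarith
    by_cases h3 : j = i + 1
    · simp only [h3, true_or, or_true, iff_true, if_true]
      constructor <;> split_ifs <;> linarith
    simp only [h2, h3, false_or, if_false]
    split_ifs with h4
    · exact ⟨by linarith, iff_of_true (by linarith) h4⟩
    · exact ⟨by linarith, iff_of_false (by linarith) h4⟩

theorem perturbedCycleMatrix_diag (hn : 2 ≤ n) (hb : b ≠ 0) {ε : ℝ} (hε : ε ^ 2 = 1) (u : ZMod n) :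
    perturbedCycleMatrix n b ε ρ u u = 2 + if u = 0 ∨ u = b then ρ else 0 := by
  have h1 : (1 : ZMod n) ≠ 0 := by exact_mod_cast natCast_zmod_ne_zero one_pos (by omega : 1 < n)
  have h2 : u ≠ u + 1 := by simpa using h1
  simp only [perturbedCycleMatrix, of_apply, if_neg h2, if_true]
  by_cases h3 : u = 0
  · simp [h3, hb.symm]
  · by_cases h4 : u = b
    · simp [h4, hb, ← pow_two, hε]
    · simp [h3, h4]

variable [NeZero n]

section Facts

variable {u v : ZMod n} {ε τ : ℝ}

/-- The ends of the chord are the vertices at which the diagonal of the matrix has the extra summand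
`ρ`. -/
theorem mem_ends_iff_of_isPSTAt (hn : 2 ≤ n) (hb : b ≠ 0) (hρ : 0 < ρ) (hε : ε ^ 2 = 1)
    (h : IsPSTAt (perturbedCycleMatrix n b ε ρ) (vertexState u) (vertexState v) τ) :
    u = 0 ∨ u = b ↔ v = 0 ∨ v = b := by
  have h1 := diag_eq_of_isPSTAt h
  rw [perturbedCycleMatrix_diag hn hb hε, perturbedCycleMatrix_diag hn hb hε] at h1
  by_cases h2 : u = 0 ∨ u = b <;> by_cases h3 : v = 0 ∨ v = b <;> simp [h2, h3] at h1 ⊢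
  · exact hρ.ne' h1
  · exact hρ.ne' h1

/-- At most one element of an integral support exceeds `4`. If there is none, `μ` is a dummy value. -/
theorem exists_forall_eq_or_eq (hε : ε ^ 2 = 1) (hρ : 0 < ρ)
    (hint : ∀ θ ∈ eigenvalueSupport (perturbedCycleMatrix n b ε ρ) u, ∃ k : ℤ, θ = k) :
    ∃ μ : ℝ, ∀ θ ∈ eigenvalueSupport (perturbedCycleMatrix n b ε ρ) u, θ ≠ μ →
      θ = 0 ∨ θ = 1 ∨ θ = 2 ∨ θ = 3 ∨ θ = 4 := by
  have hsmall : ∀ θ ∈ eigenvalueSupport (perturbedCycleMatrix n b ε ρ) u, θ ≤ 4 →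
      θ = 0 ∨ θ = 1 ∨ θ = 2 ∨ θ = 3 ∨ θ = 4 := by
    intro θ hθ h4
    obtain ⟨x, hx, hxu⟩ := mem_eigenvalueSupport.1 hθ
    have h0 := eigenvalue_nonneg hε hρ (fun h => hxu (by simp [h])) hx
    obtain ⟨k, rfl⟩ := hint θ hθ
    have hk0 : 0 ≤ k := by exact_mod_cast h0
    have hk4 : k ≤ 4 := by exact_mod_cast h4
    interval_cases k <;> simp
  by_cases hex : ∃ μ ∈ eigenvalueSupport (perturbedCycleMatrix n b ε ρ) u, 4 < μ
  · obtain ⟨μ, hμ, h4⟩ := hex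
    refine ⟨μ, fun θ hθ hne => hsmall θ hθ ?_⟩
    by_contra! h5
    obtain ⟨x, hx, hxu⟩ := mem_eigenvalueSupport.1 hθ
    obtain ⟨y, hy, hyu⟩ := mem_eigenvalueSupport.1 hμ
    exact hne (eigenvalue_unique_of_four_lt hε (fun h => hxu (by simp [h]))
      (fun h => hyu (by simp [h])) hx hy h5 h4)
  · push Not at hex
    exact ⟨0, fun θ hθ _ => hsmall θ hθ (hex θ hθ)⟩

theorem exists_rational_polynomial_perturbedCycle (ε ρ : ℤ) (g : ℚ[X]) :
    ∃ q : ℚ[X], q.map (algebraMap ℚ ℝ) =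
      ∏ t ∈ (eigenvalueSupport (perturbedCycleMatrix n b ε ρ) u).image
        (fun θ => (g.map (algebraMap ℚ ℝ)).eval θ), (X - C t) := by
  obtain ⟨Z, hZ⟩ := perturbedCycleMatrix_eq_map_intCast b ε ρ
  have h1 : perturbedCycleMatrix n b ε ρ = (Z.map (Int.cast : ℤ → ℚ)).map (Rat.cast : ℚ → ℝ) := by
    rw [hZ]; ext i j; simp
  have h2 := perturbedCycleMatrix_isSymm b (ε : ℝ) (ρ : ℝ)
  rw [h1] at h2 ⊢
  exact exists_rational_polynomial_eigenvalueSupport h2 u g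

theorem isIntegral_perturbedCycle (ε ρ : ℤ) :
    ∀ θ ∈ eigenvalueSupport (perturbedCycleMatrix n b ε ρ) u, IsIntegral ℤ θ := by
  obtain ⟨Z, hZ⟩ := perturbedCycleMatrix_eq_map_intCast b ε ρ
  rw [hZ]
  exact fun θ hθ => isIntegral_of_mem_eigenvalueSupport hθ

end Facts

theorem not_admitsVertexPST_signless (hn : 9 ≤ n) (hb : b ≠ 0) (r : ℤ) (hr : 0 < r) :
    ¬ AdmitsVertexPST (perturbedCycleMatrix n b 1 r) := by
  rintro ⟨u, v, huv, τ, hτ, h⟩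
  have hρ : (0 : ℝ) < r := by exact_mod_cast hr
  have hM := perturbedCycleMatrix_isSymm b 1 (r : ℝ)
  have hN := isAdapted_signless (b := b) hρ
  have hint := isIntegral_perturbedCycle (b := b) (u := u) 1 r
  have hrat := exists_rational_polynomial_perturbedCycle (b := b) (u := u) 1 r
  rw [Int.cast_one] at hint hrat
  set M := perturbedCycleMatrix n b 1 (r : ℝ)
  set S := eigenvalueSupport M u with hS
  have hsmall : ∀ R : Finset ℝ, R.card ≤ 3 → ¬ S ⊆ R := by
    intro R hR hSR
    obtain ⟨f, hf, hd, h0⟩ := (supportedOn_single hSR).exists_monic hM hR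
    have := hN.le_eight_of_cubic hf hd h0
    omega
  have hplus : ∀ R : Finset ℝ, R.card ≤ 2 → ¬ plusSupport M u v ⊆ R := by
    intro R hR hSR
    obtain ⟨f, hf, hd, h0⟩ := SupportedOn.exists_monic hM
      (fun x θ hx hz => hSR (supportedOn_plusSupport hM h x θ hx hz)) hR
    have := hN.le_eight_of_quadratic_add hf hd h0
    omega
  have hminus : ∀ R : Finset ℝ, R.card ≤ 2 → ¬ minusSupport M u v ⊆ R := by
    intro R hR hSR
    obtain ⟨f, hf, hd, h0⟩ := SupportedOn.exists_monic hM
      (fun x θ hx hz => hSR (supportedOn_minusSupport hM h x θ hx hz)) hR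
    have := hN.le_eight_of_quadratic_sub hb huv
      (mem_ends_iff_of_isPSTAt (by omega) hb hρ (one_pow 2) h) hf hd h0
    omega
  have hfour : ∀ θ ∈ S, θ ≠ 4 := by
    intro θ hθ
    obtain ⟨x, hx, hxu⟩ := mem_eigenvalueSupport.1 hθ
    exact eigenvalue_ne_four hρ (fun h => hxu (by simp [h])) hx
  have hints : ∀ θ ∈ S, ∃ k : ℤ, θ = k := by
    refine (forall_int_or_card_le_three hτ hrat hint
      (fun θ hθ θ' hθ' => exists_int_mul_eq_sub hM h hθ hθ') ?_ (fun h4 => hfour 4 h4 rfl) ?_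
      ?_).resolve_right fun ⟨R, hR, hSR⟩ => hsmall R hR hSR
    · intro θ hθ
      obtain ⟨x, hx, hxu⟩ := mem_eigenvalueSupport.1 hθ
      exact eigenvalue_nonneg (one_pow 2) hρ (fun h => hxu (by simp [h])) hx
    · intro θ hθ θ' hθ' h1 h2
      obtain ⟨x, hx, hxu⟩ := mem_eigenvalueSupport.1 hθ
      obtain ⟨y, hy, hyu⟩ := mem_eigenvalueSupport.1 hθ'
      exact eigenvalue_unique_of_four_lt (one_pow 2) (fun h => hxu (by simp [h]))
        (fun h => hyu (by simp [h])) hx hy h1 h2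
    · obtain ⟨x, μ, hx, hμ, hx0⟩ := exists_pos_eigenvector (b := b) hρ
      exact ⟨μ, mem_eigenvalueSupport.2 ⟨x, hx, hx0 u⟩, hμ⟩
  obtain ⟨μ, hμ⟩ := exists_forall_eq_or_eq (one_pow 2) hρ hints
  have hpair : ∀ T ⊆ S, μ ∉ T → (∀ t ∈ T, t + 1 ∉ T) → ∃ a c : ℝ, T ⊆ {a, c} := by
    intro T hTS hμT hT
    obtain ⟨a, c, hac⟩ := exists_pair_of_forall_add_one_notMem
      (fun t ht => hμ t (hTS ht) fun h => hμT (h ▸ ht)) hT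
    refine ⟨a, c, fun t ht => ?_⟩
    have h1 := hac ht
    have h2 := hfour t (hTS ht)
    simpa [h2] using h1
  rcases forall_add_one_notMem_or_exp_eq_neg_one hM h huv hints with h1 | hE
  · obtain ⟨a, c, hac⟩ := hpair (S.erase μ) (Finset.erase_subset _ _) (Finset.notMem_erase _ _)
      fun t ht ht' => h1 t (Finset.mem_of_mem_erase ht) (Finset.mem_of_mem_erase ht')
    exact hsmall {μ, a, c} Finset.card_le_three (Finset.subset_insert_iff.2 hac)
  · by_cases hμm : μ ∈ minusSupport M u v
    · obtain ⟨a, c, hac⟩ := hpair _ (plusSupport_subset M u v)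
        (fun hμp => by
          have := exp_eq_neg_one_of_mem hM h hμm hμp
          rw [sub_self, mul_zero, Complex.exp_zero] at this
          norm_num at this)
        fun t ht => add_one_notMem_plusSupport hM h hE ht
      exact hplus _ Finset.card_le_two hac
    · obtain ⟨a, c, hac⟩ := hpair _ (minusSupport_subset M u v) hμm
        fun t ht => add_one_notMem_minusSupport hM h hE ht
      exact hminus _ Finset.card_le_two hac

theorem not_admitsVertexPST_laplacian (hn : 14 ≤ n) (hb : b ≠ 0) (r : ℤ) (hr : 0 < r) :
    ¬ AdmitsVertexPST (perturbedCycleMatrix n b (-1) r) := by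
  rintro ⟨u, v, huv, τ, hτ, h⟩
  have hρ : (0 : ℝ) < r := by exact_mod_cast hr
  have hε : (-1 : ℝ) ^ 2 = 1 := by norm_num
  have hM := perturbedCycleMatrix_isSymm b (-1) (r : ℝ)
  have hN := isAdapted_laplacian (b := b) hρ
  have hint := isIntegral_perturbedCycle (b := b) (u := u) (-1) r
  have hrat := exists_rational_polynomial_perturbedCycle (b := b) (u := u) (-1) r X
  rw [Int.cast_neg, Int.cast_one] at hint hrat
  simp only [map_X, eval_X, Finset.image_id'] at hrat
  have hone : perturbedCycleMatrix n b (-1) (r : ℝ) *ᵥ (fun _ => 1) = (0 : ℝ) • fun _ => 1 := by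
    ext i
    rw [perturbedCycleMatrix_mulVec]
    simp only [Pi.smul_apply, smul_eq_mul]
    ring
  set M := perturbedCycleMatrix n b (-1) (r : ℝ)
  set N := (3 + (r : ℝ)) • (1 : Matrix (ZMod n) (ZMod n) ℝ) - M with hNdef
  have hNs : N.IsSymm := by
    rw [IsSymm, hNdef, transpose_sub, hM.eq, transpose_smul, transpose_one]
  set S := eigenvalueSupport M u with hS
  have hannih : ∀ {z : ZMod n → ℝ} {R : Finset ℝ} {d : ℕ}, SupportedOn M z R → R.card ≤ d →
      ∃ f : ℝ[X], f.Monic ∧ f.natDegree = d ∧ aeval N f *ᵥ z = 0 := fun hz hR =>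
    (hz.const_sub (3 + (r : ℝ))).exists_monic hNs (Finset.card_image_le.trans hR)
  have h0S : (0 : ℝ) ∈ plusSupport M u v := mem_plusSupport.2 ⟨_, hone, one_ne_zero, rfl⟩
  have hints : ∀ θ ∈ S, ∃ k : ℤ, θ = k := by
    refine forall_int_of_zero_mem hτ (exists_rat_eq_sum_of_map_eq hrat.choose_spec)
      (plusSupport_subset _ _ _ h0S) ?_ hint
      (fun θ hθ θ' hθ' => exists_int_mul_eq_sub hM h hθ hθ')
    intro θ hθ
    obtain ⟨x, hx, hxu⟩ := mem_eigenvalueSupport.1 hθ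
    exact eigenvalue_nonneg hε hρ (fun h => hxu (by simp [h])) hx
  have hdisj : ∀ θ ∈ minusSupport M u v, θ ∉ plusSupport M u v := by
    intro θ hm hp
    have := exp_eq_neg_one_of_mem hM h hm hp
    rw [sub_self, mul_zero, Complex.exp_zero] at this
    norm_num at this
  obtain ⟨μ, hμ⟩ := exists_forall_eq_or_eq hε hρ hints
  rcases forall_add_one_notMem_or_exp_eq_neg_one hM h huv hints with h1 | hE
  · obtain ⟨a, c, hac⟩ := exists_pair_of_forall_add_one_notMem (T := S.erase μ)
      (fun t ht => hμ t (Finset.mem_of_mem_erase ht) (Finset.ne_of_mem_erase ht))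
      fun t ht ht' => h1 t (Finset.mem_of_mem_erase ht) (Finset.mem_of_mem_erase ht')
    obtain ⟨f, hf, hd, h0⟩ := hannih (supportedOn_single
      (Finset.subset_insert_iff.2 hac)) Finset.card_le_four
    have := hN.le_thirteen_of_quartic hf hd h0
    omega
  · by_cases hμm : μ ∈ minusSupport M u v
    · obtain ⟨a, c, hac⟩ := exists_pair_of_forall_add_one_notMem (T := plusSupport M u v)
        (fun t ht => hμ t (plusSupport_subset M u v ht) fun h => hdisj μ hμm (h ▸ ht))
        fun t ht => add_one_notMem_plusSupport hM h hE ht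
      obtain ⟨f, hf, hd, h0⟩ := hannih (fun x θ hx hz =>
        hac (supportedOn_plusSupport hM h x θ hx hz)) Finset.card_le_three
      have := hN.le_thirteen_of_cubic_add hf hd h0
      omega
    · -- As `0` is in the plus part and `exp (i τ) = -1`, no even number is in the minus part.
      have hodd : minusSupport M u v ⊆ {1, 3} := by
        intro t ht
        have h2 := exp_eq_neg_one_of_mem hM h ht h0S
        have heven : ∀ k : ℕ, t ≠ (2 * k : ℕ) := by
          rintro k rfl
          have h3 : Complex.I * τ * (((2 * k : ℕ) : ℝ) - (0 : ℝ)) =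
              (2 * k : ℕ) * (Complex.I * τ) := by push_cast; ring
          rw [h3, Complex.exp_nat_mul, hE, pow_mul] at h2
          norm_num at h2
        have h4 := heven 0
        have h5 := heven 1
        have h6 := heven 2
        norm_num at h4 h5 h6
        have h7 := hμ t (minusSupport_subset M u v ht) fun h => hμm (h ▸ ht)
        simpa [h4, h5, h6] using h7
      obtain ⟨f, hf, hd, h0⟩ := hannih (fun x θ hx hz =>
        hodd (supportedOn_minusSupport hM h x θ hx hz)) Finset.card_le_two
      have := hN.le_eight_of_quadratic_sub hb huv
        (mem_ends_iff_of_isPSTAt (by omega) hb hρ hε h) hf hd h0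
      omega

end NoTransfer

theorem theorem3p4 (n : ℕ) [NeZero n] (b : ZMod n) (hb : b ≠ 0) (ρ : ℕ) (hρ : 0 < ρ) :
    (15 ≤ n →
      ¬ AdmitsVertexPST
        (edgePerturbedCycle n b hb (ρ : ℝ) (Nat.cast_pos.mpr hρ)).laplacian) ∧
    (9 ≤ n →
      ¬ AdmitsVertexPST
        (edgePerturbedCycle n b hb (ρ : ℝ) (Nat.cast_pos.mpr hρ)).signlessLaplacian) := by
  have hcast : (ρ : ℝ) = ((ρ : ℤ) : ℝ) := by simp
  have hρ' : (0 : ℤ) < ρ := by exact_mod_cast hρ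
  constructor
  · intro hn
    rw [laplacian_eq (by omega), hcast]
    exact not_admitsVertexPST_laplacian (by omega) hb ρ hρ'
  · intro hn
    rw [signlessLaplacian_eq (by omega), hcast]
    exact not_admitsVertexPST_signless hn hb ρ hρ'
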